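/- Let $\Gamma=\{1,\dots,m\}$, let $f_\gamma:\mathbb R^n\to\mathbb R^n$ ($\gamma\in\Gamma$) be continuous, and write $f(\xi,\gamma)=f_\gamma(\xi)$. A switching signal is a right-continuous, piecewise constant function $\sigma:[0,\infty)\to\Gamma$, with switching times $t_0=0<t_1<t_2<\cdots$, where $t_1,t_2,\dots$ are its discontinuities, finitely many in every bounded interval. A trajectory $(x,\sigma)$ of $\dot x=f(x,\sigma)$ consists of a switching signal $\sigma$ and a continuous curve $x:I\to\mathbb R^n$, $I=[0,T)$ or $[0,T]$, $T>0$ (also $I=[0,\infty)$), with $\dot x(t)=f_{\sigma(t)}(x(t))$ for all $t\in I$ that are not switching times; it is maximal if $x$ has no proper extension to a solution for the same $\sigma$. Let $\chi=\{\chi_\gamma\}_{\gamma\in\Gamma}$ be closed sets with $\bigcup_\gamma\chi_\gamma=\mathbb R^n$, and suppose that $f_\gamma(0)=0$ whenever $0\in\chi_\gamma$. For $\tau_D>0$ and $N_0\in\mathbb N$ let $\mathcal T_a[\tau_D,N_0]$ be the set of maximal trajectories $(x,\sigma)$ such that every interval $(a,b)$, $0\le a<b<\infty$, contains at most $N_0+(b-a)/\tau_D$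 switching times of $\sigma$, and let $\mathcal T_a=\bigcup_{\tau_D>0,\,N_0>0}\mathcal T_a[\tau_D,N_0]$. Let $\mathcal T'\subseteq\mathcal T_a$ be a family of maximal trajectories such that $x(t)\in\chi_{\sigma(t)}$ for all $(x,\sigma)\in\mathcal T'$ and all $t$ in the domain of $x$. A function $\alpha:[0,\infty)\to[0,\infty)$ is of class $\mathcal K_\infty$ if it is continuous, strictly increasing and unbounded with $\alpha(0)=0$; $\beta:[0,\infty)^2\to[0,\infty)$ is of class $\mathcal{KL}$ if $\beta(\cdot,t)\in\mathcal K_\infty$ for every $t$ and $\beta(r,\cdot)$ decreases to $0$ for every $r$. Suppose that there is a weak Lyapunov-like function $V:\mathbb R^n\times\Gamma\to\mathbb R$ for $\mathcal T'$, that is, $V(\cdot,\gamma)$ is continuously differentiable for each $\gamma$ and 1. there are $\alpha_1,\alpha_2\in\mathcal K_\infty$ with $\alpha_1(|\xi|)\le V(\xi,\gamma)\le\alpha_2(|\xi|)$ whenever $\xi\in\chi_\gamma$; 2. $\frac{\partial V}{\partial\xi}(\xi,\gamma)f(\xi,\gamma)\le 0$ whenever $\xi\in\chi_\gamma$; 3.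 for all $(x,\sigma)\in\mathcal T'$ and all switching times $t_i<t_j$ (in the domain of $x$, and $t_0=0$ included) with $\sigma(t_i)=\sigma(t_j)$, $V(x(t_j),\sigma(t_j))\le V(x(t_{i+1}),\sigma(t_i))$. Suppose in addition that there are continuous functions $W_\gamma:\mathbb R^n\to[0,\infty)$, $\gamma\in\Gamma$, such that (i) $\frac{\partial V}{\partial\xi}(\xi,\gamma)f(\xi,\gamma)\le -W_\gamma(\xi)$ whenever $\xi\in\chi_\gamma$; (ii) for each $\gamma\in\Gamma$ the system $\dot x=f_\gamma(x)$, $y=W_\gamma(x)$ is zero small-time distinguishable: for every $\delta>0$ and every solution $x$ of $\dot x=f_\gamma(x)$ on $[0,\delta)$ with $W_\gamma(x(t))=0$ for all $t\in[0,\delta)$, one has $x(0)=0$. Then $\mathcal T'$ is globally asymptotically stable: every $(x,\sigma)\in\mathcal T'$ is defined on $[0,\infty)$ and satisfies $x(t)\to0$ as $t\to\infty$, and there is $\alpha\in\mathcal K_\infty$ such that $|x(t)|\le\alpha(|x(t_0)|)$ for all $(x,\sigma)\in\mathcal T'$ and all $t\ge t_0\ge0$. If, in addition, $\mathcal T'\subseteq\mathcal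 T_a[\tau_D,N_0]$ for some $\tau_D>0$ and $N_0\in\mathbb N$, then $\mathcal T'$ is globally uniformly asymptotically stable: there is $\beta\in\mathcal{KL}$ such that $|x(t)|\le\beta(|x(t_0)|,t-t_0)$ for all $(x,\sigma)\in\mathcal T'$ and all $t\ge t_0\ge0$. -/

import Mathlib

open Set Filter Topology
open scoped NNReal

namespace SwitchedSystem

/-- Class `𝒦_∞`: strictly increasing, continuous, zero at zero, unbounded. -/
structure IsClassKInfty (α : ℝ≥0 → ℝ≥0) : Prop where
  strictMono : StrictMono α
  continuous : Continuous α
  map_zero : α 0 = 0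
  unbounded : ∀ M : ℝ≥0, ∃ s : ℝ≥0, M < α s

/-- Class `𝒦ℒ`: of class `𝒦_∞` in the first argument (for every value of the second one), and
decreasing to zero in the second argument. -/
structure IsClassKL (β : ℝ≥0 → ℝ≥0 → ℝ≥0) : Prop where
  left : ∀ t : ℝ≥0, IsClassKInfty fun r => β r t
  right_antitone : ∀ r : ℝ≥0, Antitone (β r)
  right_tendsto : ∀ r : ℝ≥0, Tendsto (β r) atTop (𝓝 0)

/-- The discontinuities of `σ : [0, ∞) → Γ` with `Γ = {1, …, m}` discrete. A signal is a function
on `ℝ` whose values at negative times are irrelevant; right continuity at `0` is part of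
`IsSwitchingSignal`. -/
def discontinuities {m : ℕ} (σ : ℝ → Fin m) : Set ℝ :=
  {t : ℝ | 0 < t ∧ ¬ ContinuousAt σ t}

/-- The switching times `t₀ = 0 < t₁ < t₂ < …` of `σ`, where `t₁, t₂, …` are its consecutive
discontinuities. -/
def switchingTimes {m : ℕ} (σ : ℝ → Fin m) : Set ℝ :=
  insert 0 (discontinuities σ)

/-- Switching signals: piecewise constant (finitely many discontinuities in bounded time) and
continuous from the right. -/
structure IsSwitchingSignal {m : ℕ} (σ : ℝ → Fin m) : Prop where
  right_continuous : ∀ t : ℝ, 0 ≤ t → ContinuousWithinAt σ (Ici t) t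
  locally_finite : ∀ T : ℝ, (discontinuities σ ∩ Iic T).Finite

/-- The intervals `[0, ∞)`, `[0, T)` and `[0, T]` with `0 < T < ∞`. -/
def IsTimeInterval (I : Set ℝ) : Prop :=
  I = Ici 0 ∨ ∃ T : ℝ, 0 < T ∧ (I = Ico 0 T ∨ I = Icc 0 T)

/-- `x` is a solution on `I` of `ẋ = f(x, σ)`: a curve on `I` that satisfies the differential
equation at all times of `I` other than the switching times (one-sided derivative at a right
end point that belongs to `I`). The values of `x` outside `I` are irrelevant. -/
structure IsSolution {n m : ℕ}
    (f : Fin m → EuclideanSpace ℝ (Fin n) → EuclideanSpace ℝ (Fin n))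
    (σ : ℝ → Fin m) (x : ℝ → EuclideanSpace ℝ (Fin n)) (I : Set ℝ) : Prop where
  interval : IsTimeInterval I
  continuousOn : ContinuousOn x I
  ode : ∀ t ∈ I, t ∉ switchingTimes σ → HasDerivWithinAt x (f (σ t) (x t)) I t

/-- A solution is maximal if it has no proper extension to a solution for the same signal. -/
def IsMaximalSolution {n m : ℕ}
    (f : Fin m → EuclideanSpace ℝ (Fin n) → EuclideanSpace ℝ (Fin n))
    (σ : ℝ → Fin m) (x : ℝ → EuclideanSpace ℝ (Fin n)) (I : Set ℝ) : Prop :=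
  IsSolution f σ x I ∧
    ∀ (y : ℝ → EuclideanSpace ℝ (Fin n)) (J : Set ℝ),
      IsSolution f σ y J → I ⊆ J → EqOn x y I → J = I

/-- A trajectory `(x, σ)` of `ẋ = f(x, σ)`: a switching signal and a corresponding solution
`state`, defined on the interval `dom`. -/
structure Trajectory {n m : ℕ}
    (f : Fin m → EuclideanSpace ℝ (Fin n) → EuclideanSpace ℝ (Fin n)) where
  state : ℝ → EuclideanSpace ℝ (Fin n)
  signal : ℝ → Fin m
  dom : Set ℝ
  isSwitchingSignal : IsSwitchingSignal signal
  isSolution : IsSolution f signal state dom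

section Families

variable {n m : ℕ}

/-- The family `𝒯` of all maximal trajectories. -/
def maximalTrajectories (f : Fin m → EuclideanSpace ℝ (Fin n) → EuclideanSpace ℝ (Fin n)) :
    Set (Trajectory f) :=
  {p | IsMaximalSolution f p.signal p.state p.dom}

/-- `χ` is a closed covering of `ℝⁿ`. -/
structure IsClosedCovering (χ : Fin m → Set (EuclideanSpace ℝ (Fin n))) : Prop where
  closed : ∀ γ, IsClosed (χ γ)
  covers : ⋃ γ, χ γ = univ

/-- The family `𝒯[χ]` of the maximal trajectories with `x(t) ∈ χ_{σ(t)}` throughout. -/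
def coveringTrajectories (f : Fin m → EuclideanSpace ℝ (Fin n) → EuclideanSpace ℝ (Fin n))
    (χ : Fin m → Set (EuclideanSpace ℝ (Fin n))) : Set (Trajectory f) :=
  {p | p ∈ maximalTrajectories f ∧ ∀ t ∈ p.dom, p.state t ∈ χ (p.signal t)}

/-- `σ` has average dwell-time `τD` and chatter bound `N0`. -/
def HasAverageDwellTime (τD : ℝ) (N0 : ℕ) (σ : ℝ → Fin m) : Prop :=
  ∀ a b : ℝ, 0 ≤ a → a < b →
    ((switchingTimes σ ∩ Ioo a b).ncard : ℝ) ≤ N0 + (b - a) / τD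

/-- The family `𝒯_a[τD, N0]`. -/
def dwellTrajectories (f : Fin m → EuclideanSpace ℝ (Fin n) → EuclideanSpace ℝ (Fin n))
    (τD : ℝ) (N0 : ℕ) : Set (Trajectory f) :=
  {p | p ∈ maximalTrajectories f ∧ HasAverageDwellTime τD N0 p.signal}

/-- The family `𝒯_a`, the union of all `𝒯_a[τD, N0]` with `τD > 0` and `N0 > 0`. -/
def averageDwellTrajectories
    (f : Fin m → EuclideanSpace ℝ (Fin n) → EuclideanSpace ℝ (Fin n)) : Set (Trajectory f) :=
  {p | ∃ (τD : ℝ) (N0 : ℕ), 0 < τD ∧ 0 < N0 ∧ p ∈ dwellTrajectories f τD N0}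

variable {f : Fin m → EuclideanSpace ℝ (Fin n) → EuclideanSpace ℝ (Fin n)}

/-- Uniform stability. The estimate is for all `t ≥ t₀ ≥ 0`, so that the trajectories have to be
defined on all of `[0, ∞)`. -/
def UniformlyStable (T' : Set (Trajectory f)) : Prop :=
  ∃ α : ℝ≥0 → ℝ≥0, IsClassKInfty α ∧ ∀ p ∈ T', p.dom = Ici 0 ∧
    ∀ t₀ t : ℝ, 0 ≤ t₀ → t₀ ≤ t → ‖p.state t‖₊ ≤ α ‖p.state t₀‖₊

/-- Global asymptotic stability. -/
def GloballyAsymptoticallyStable (T' : Set (Trajectory f)) : Prop :=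
  UniformlyStable T' ∧ ∀ p ∈ T', Tendsto p.state atTop (𝓝 0)

/-- Global uniform asymptotic stability. -/
def GloballyUniformlyAsymptoticallyStable (T' : Set (Trajectory f)) : Prop :=
  ∃ β : ℝ≥0 → ℝ≥0 → ℝ≥0, IsClassKL β ∧ ∀ p ∈ T', p.dom = Ici 0 ∧
    ∀ t₀ t : ℝ, 0 ≤ t₀ → t₀ ≤ t → ‖p.state t‖₊ ≤ β ‖p.state t₀‖₊ (t - t₀).toNNReal

/-- `V` is a weak Lyapunov-like function for the family `T'`, with respect to the covering `χ`. In
`switching`, `s = t_i`, `s' = t_{i+1}` and `t = t_j`. -/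
structure IsWeakLyapunovLike (χ : Fin m → Set (EuclideanSpace ℝ (Fin n)))
    (T' : Set (Trajectory f)) (V : EuclideanSpace ℝ (Fin n) → Fin m → ℝ) : Prop where
  contDiff : ∀ γ, ContDiff ℝ 1 fun ξ => V ξ γ
  bounds : ∃ α₁ α₂ : ℝ≥0 → ℝ≥0, IsClassKInfty α₁ ∧ IsClassKInfty α₂ ∧
    ∀ γ, ∀ ξ ∈ χ γ, (α₁ ‖ξ‖₊ : ℝ) ≤ V ξ γ ∧ V ξ γ ≤ α₂ ‖ξ‖₊
  decreasing : ∀ γ, ∀ ξ ∈ χ γ, fderiv ℝ (fun η => V η γ) ξ (f γ ξ) ≤ 0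
  switching : ∀ p ∈ T', ∀ s s' t : ℝ,
    s ∈ switchingTimes p.signal → t ∈ switchingTimes p.signal → t ∈ p.dom → s < t →
    IsLeast {r | r ∈ switchingTimes p.signal ∧ s < r} s' → p.signal s = p.signal t →
    V (p.state t) (p.signal t) ≤ V (p.state s') (p.signal s)

end Families

/-- The system `ẋ = g(x)`, `y = w(x)` is zero small-time distinguishable: for every `δ > 0`, every
solution `x` on `[0, δ)` along which the output vanishes starts at `0`. -/
def ZeroSmallTimeDistinguishable {n : ℕ}
    (g : EuclideanSpace ℝ (Fin n) → EuclideanSpace ℝ (Fin n))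
    (w : EuclideanSpace ℝ (Fin n) → ℝ) : Prop :=
  ∀ (δ : ℝ) (x : ℝ → EuclideanSpace ℝ (Fin n)), 0 < δ →
    ContinuousOn x (Ico 0 δ) → (∀ t ∈ Ioo 0 δ, HasDerivAt x (g (x t)) t) →
    (∀ t ∈ Ico 0 δ, w (x t) = 0) → x 0 = 0

end SwitchedSystem

/-!
The value of `V` at the active mode does not increase between switches, and condition 3 prevents it
from growing from one activation of a mode to the next. As long as no new mode is activated, the
norm is thus bounded by `id + α₁⁻¹ ∘ α₂` of its value at the first activation of one of the modes.
There are only `m` modes, so the `m`-th iterate of this function bounds the norm for all times.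

For attractivity, follow a trajectory that stays in a compact shell `δ ≤ ‖ξ‖ ≤ R`. On an interval
without switches, of a length bounded below, `V` drops by a fixed amount: otherwise a limit of arcs
on such intervals would be a solution of some `ẋ = f_γ(x)` in the shell along which `W_γ`
vanishes, contradicting small-time distinguishability. A signal with average dwell-time `τD` and
chatter bound `N0` has such an interval in every window of length `τD`, and by the pigeonhole
principle many of them belong to the same mode, for which the drops accumulate. As `V` is bounded
on the shell, the trajectory enters every ball around the origin in a time depending only on the
initial norm. The resulting worst-case norm is monotone in the initial norm, and averaging makes
it continuous, hence a `𝒦ℒ` bound.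
-/

namespace SwitchedSystem

section SolutionArcs

variable {E : Type*} [NormedAddCommGroup E] [NormedSpace ℝ E] {g : E → E} {x : ℝ → E} {a b : ℝ}

/-- Solutions of `ẋ = g(x)` on a compact interval `[a, b]`: the pieces of a trajectory between two
consecutive switching times. The equation is imposed on the open interval only; for continuous `g`
the one-sided derivatives at the end points follow from it. -/
structure IsSolutionArc (g : E → E) (x : ℝ → E) (a b : ℝ) : Prop where
  continuousOn : ContinuousOn x (Icc a b)
  hasDerivAt : ∀ t ∈ Ioo a b, HasDerivAt x (g (x t)) t

namespace IsSolutionArc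

theorem mono {c d : ℝ} (hx : IsSolutionArc g x a b) (hac : a ≤ c) (hdb : d ≤ b) :
    IsSolutionArc g x c d :=
  ⟨hx.continuousOn.mono (Icc_subset_Icc hac hdb),
    fun t ht => hx.hasDerivAt t (Ioo_subset_Ioo hac hdb ht)⟩

theorem congr {y : ℝ → E} (hx : IsSolutionArc g x a b) (hy : EqOn y x (Icc a b)) :
    IsSolutionArc g y a b := by
  refine ⟨hx.continuousOn.congr hy, fun t ht => ?_⟩
  rw [hy (Ioo_subset_Icc_self ht)]
  exact (hx.hasDerivAt t ht).congr_of_eventuallyEq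
    (hy.eventuallyEq_of_mem (Icc_mem_nhds ht.1 ht.2))

theorem comp_add_const (hx : IsSolutionArc g x a b) (c : ℝ) :
    IsSolutionArc g (fun t => x (t + c)) (a - c) (b - c) := by
  refine ⟨hx.continuousOn.comp (by fun_prop) fun t ht => ?_, fun t ht => ?_⟩
  · exact ⟨sub_le_iff_le_add.1 ht.1, le_sub_iff_add_le.1 ht.2⟩
  · have hmem : t + c ∈ Ioo a b := ⟨sub_lt_iff_lt_add.1 ht.1, lt_sub_iff_add_lt.1 ht.2⟩
    exact (hx.hasDerivAt (t + c) hmem).comp_add_const t c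

theorem hasDerivWithinAt (hg : Continuous g) (hab : a < b) (hx : IsSolutionArc g x a b) {t : ℝ}
    (ht : t ∈ Icc a b) : HasDerivWithinAt x (g (x t)) (Icc a b) t := by
  have hdiff : DifferentiableOn ℝ x (Ioo a b) := fun s hs =>
    (hx.hasDerivAt s hs).differentiableAt.differentiableWithinAt
  have hderiv : Tendsto (deriv x) (𝓝[Ioo a b] t) (𝓝 (g (x t))) := by
    refine ((hg.comp_continuousOn hx.continuousOn t ht).mono Ioo_subset_Icc_self).congr' ?_
    filter_upwards [self_mem_nhdsWithin] with s hs using (hx.hasDerivAt s hs).deriv.symm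
  have hcont : ContinuousWithinAt x (Ioo a b) t := (hx.continuousOn t ht).mono Ioo_subset_Icc_self
  rcases ht.1.eq_or_lt with rfl | hat
  · rw [nhdsWithin_Ioo_eq_nhdsGT hab] at hderiv
    exact (hasDerivWithinAt_Ici_of_tendsto_deriv hdiff hcont (Ioo_mem_nhdsGT hab) hderiv).mono
      Icc_subset_Ici_self
  rcases ht.2.eq_or_lt with rfl | htb
  · rw [nhdsWithin_Ioo_eq_nhdsLT hab] at hderiv
    exact (hasDerivWithinAt_Iic_of_tendsto_deriv hdiff hcont (Ioo_mem_nhdsLT hab) hderiv).mono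
      Icc_subset_Iic_self
  · exact (hx.hasDerivAt t ⟨hat, htb⟩).hasDerivWithinAt

theorem lipschitzOnWith {M : ℝ≥0} (hx : IsSolutionArc g x a b)
    (hM : ∀ t ∈ Ioo a b, ‖g (x t)‖₊ ≤ M) : LipschitzOnWith M x (Icc a b) := by
  rcases lt_or_ge a b with hab | hba
  · have hc := hx.continuousOn
    rw [← closure_Ioo hab.ne] at hc ⊢
    exact LipschitzOnWith.closure hc
      ((convex_Ioo a b).lipschitzOnWith_of_nnnorm_hasDerivWithin_le
        (fun t ht => (hx.hasDerivAt t ht).hasDerivWithinAt) hM)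
  · exact fun s hs t ht => by simp [subsingleton_Icc_of_ge hba hs ht]

theorem hasDerivAt_comp {v : E → ℝ} (hv : Differentiable ℝ v) (hx : IsSolutionArc g x a b) {t : ℝ}
    (ht : t ∈ Ioo a b) : HasDerivAt (fun s => v (x s)) (fderiv ℝ v (x t) (g (x t))) t :=
  (hv (x t)).hasFDerivAt.comp_hasDerivAt t (hx.hasDerivAt t ht)

theorem antitoneOn_comp {v : E → ℝ} (hv : Differentiable ℝ v) (hx : IsSolutionArc g x a b)
    (h : ∀ t ∈ Ioo a b, fderiv ℝ v (x t) (g (x t)) ≤ 0) :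
    AntitoneOn (fun t => v (x t)) (Icc a b) := by
  refine antitoneOn_of_deriv_nonpos (convex_Icc a b)
    (hv.continuous.comp_continuousOn hx.continuousOn) ?_ ?_ <;> rw [interior_Icc]
  · exact fun t ht => (hx.hasDerivAt_comp hv ht).differentiableAt.differentiableWithinAt
  · exact fun t ht => (hx.hasDerivAt_comp hv ht).deriv.trans_le (h t ht)

end IsSolutionArc

theorem exists_isSolutionArc_update [FiniteDimensional ℝ E] {K : Set E} (hab : a < b)
    (hK : IsCompact K) (hg : ContinuousOn g K) (hxc : ContinuousOn x (Ico a b))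
    (hxd : ∀ t ∈ Ioo a b, HasDerivAt x (g (x t)) t) (hxK : MapsTo x (Ioo a b) K) :
    ∃ ℓ, IsSolutionArc g (Function.update x b ℓ) a b := by
  obtain ⟨M, hM⟩ := hK.exists_bound_of_continuousOn hg
  have hlip : LipschitzOnWith M.toNNReal x (Ioo a b) :=
    (convex_Ioo a b).lipschitzOnWith_of_nnnorm_hasDerivWithin_le
      (fun t ht => (hxd t ht).hasDerivWithinAt)
      fun t ht => NNReal.le_toNNReal_of_coe_le (hM _ (hxK ht))
  obtain ⟨y, hy, hxy⟩ := hlip.extend_finite_dimension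
  have hlim : Tendsto x (𝓝[<] b) (𝓝 (y b)) := by
    refine ((hy.continuous.tendsto b).mono_left nhdsWithin_le_nhds).congr' ?_
    filter_upwards [Ioo_mem_nhdsLT hab] with t ht using (hxy ht).symm
  refine ⟨y b, ?_, fun t ht => ?_⟩
  · rw [continuousOn_update_iff, Icc_sdiff_right]
    exact ⟨hxc, fun _ => hlim.mono_left (nhdsWithin_mono b fun t ht => ht.2)⟩
  · rw [Function.update_of_ne ht.2.ne]
    refine (hxd t ht).congr_of_eventuallyEq ?_
    filter_upwards [isOpen_ne.mem_nhds ht.2.ne] with s hs using Function.update_of_ne hs _ _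

end SolutionArcs

section Compactness

variable {E : Type*} [NormedAddCommGroup E] {K : Set E}

theorem exists_subseq_tendstoUniformlyOn_of_lipschitzOnWith {X Y : Type*} [PseudoMetricSpace X]
    [MetricSpace Y] {S : Set X} {K : Set Y} (hS : IsCompact S) (hK : IsCompact K)
    {x : ℕ → X → Y} {M : ℝ≥0} (hx : ∀ k, LipschitzOnWith M (x k) S)
    (hxK : ∀ k, MapsTo (x k) S K) :
    ∃ (φ : ℕ → ℕ) (y : X → Y), StrictMono φ ∧ ContinuousOn y S ∧
      TendstoUniformlyOn (fun k => x (φ k)) y atTop S := by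
  classical
  have : CompactSpace S := isCompact_iff_compactSpace.1 hS
  let F : ℕ → BoundedContinuousFunction S Y := fun k =>
    BoundedContinuousFunction.mkOfCompact ⟨S.domRestrict (x k), (hx k).continuousOn.domRestrict⟩
  have hF : IsCompact (closure (range F)) := by
    refine BoundedContinuousFunction.arzela_ascoli K hK _ ?_ ?_
    · rintro _ t ⟨k, rfl⟩
      exact hxK k t.2
    · refine UniformEquicontinuous.equicontinuous (LipschitzWith.uniformEquicontinuous _ M ?_)
      rintro ⟨_, k, rfl⟩
      exact (hx k).to_restrict
  obtain ⟨y, -, φ, hφ, hy⟩ := hF.tendsto_subseq fun k => subset_closure (mem_range_self k)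
  rw [BoundedContinuousFunction.tendsto_iff_tendstoUniformly] at hy
  let z : X → Y := fun t => if h : t ∈ S then y ⟨t, h⟩ else x 0 t
  have hext : z ∘ ((↑) : S → X) = y := funext fun t => dif_pos t.2
  refine ⟨φ, z, hφ, ?_, ?_⟩
  · rw [continuousOn_iff_continuous_domRestrict, domRestrict_eq, hext]
    exact y.continuous
  · rwa [tendstoUniformlyOn_iff_tendstoUniformly_comp_coe, hext]

theorem tendstoUniformlyOn_comp_of_mapsTo {ι X Y Z : Type*} [PseudoMetricSpace Y]
    [PseudoMetricSpace Z] {l : Filter ι} {S : Set X} {K : Set Y} {G : ι → Y → Z} {g : Y → Z}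
    {x : ι → X → Y} {y : X → Y} (hG : TendstoUniformlyOn G g l K) (hg : UniformContinuousOn g K)
    (hx : TendstoUniformlyOn x y l S) (hxK : ∀ k, MapsTo (x k) S K) (hyK : MapsTo y S K) :
    TendstoUniformlyOn (fun k t => G k (x k t)) (fun t => g (y t)) l S := by
  rw [Metric.uniformContinuousOn_iff] at hg
  rw [Metric.tendstoUniformlyOn_iff] at hG hx ⊢
  intro ε hε
  obtain ⟨δ, hδ, hgδ⟩ := hg (ε / 2) (half_pos hε)
  filter_upwards [hx δ hδ, hG (ε / 2) (half_pos hε)] with k hxy hGg t ht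
  calc dist (g (y t)) (G k (x k t))
      ≤ dist (g (y t)) (g (x k t)) + dist (g (x k t)) (G k (x k t)) := dist_triangle _ _ _
    _ < ε / 2 + ε / 2 :=
        add_lt_add (hgδ _ (hyK ht) _ (hxK k ht) (hxy t ht)) (hGg _ (hxK k ht))
    _ = ε := add_halves ε

variable [NormedSpace ℝ E] {g : E → E}

theorem IsSolutionArc.exists_subseq_tendsto (hK : IsCompact K) (hg : ContinuousOn g K)
    {G : ℕ → E → E} (hG : TendstoUniformlyOn G g atTop K) {M : ℝ≥0}
    (hM : ∀ k, ∀ ξ ∈ K, ‖G k ξ‖₊ ≤ M) {x : ℕ → ℝ → E} {a b : ℝ}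
    (hx : ∀ k, IsSolutionArc (G k) (x k) a b) (hxK : ∀ k, MapsTo (x k) (Icc a b) K) :
    ∃ (φ : ℕ → ℕ) (y : ℝ → E), StrictMono φ ∧ IsSolutionArc g y a b ∧
      ∀ t ∈ Icc a b, Tendsto (fun k => x (φ k) t) atTop (𝓝 (y t)) := by
  obtain ⟨φ, y, hφ, hy, hlim⟩ := exists_subseq_tendstoUniformlyOn_of_lipschitzOnWith isCompact_Icc
    hK (fun k => (hx k).lipschitzOnWith fun t ht => hM k _ (hxK k (Ioo_subset_Icc_self ht))) hxK
  have hpt : ∀ t ∈ Icc a b, Tendsto (fun k => x (φ k) t) atTop (𝓝 (y t)) :=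
    fun t ht => hlim.tendsto_at ht
  have hyK : MapsTo y (Icc a b) K := fun t ht =>
    hK.isClosed.mem_of_tendsto (hpt t ht) (Eventually.of_forall fun k => hxK _ ht)
  have hvel : TendstoUniformlyOn (fun k t => G (φ k) (x (φ k) t)) (fun t => g (y t)) atTop
      (Ioo a b) :=
    (tendstoUniformlyOn_comp_of_mapsTo (fun u hu => hφ.tendsto_atTop.eventually (hG u hu))
      (hK.uniformContinuousOn_of_continuous hg) hlim (fun k => hxK (φ k)) hyK).mono
      Ioo_subset_Icc_self
  refine ⟨φ, y, hφ, ⟨hy, fun t ht => ?_⟩, hpt⟩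
  exact hasDerivAt_of_tendstoUniformlyOn isOpen_Ioo hvel
    (Eventually.of_forall fun k t ht => (hx (φ k)).hasDerivAt t ht)
    (fun t ht => hpt t (Ioo_subset_Icc_self ht)) ht

end Compactness

section Peano

variable {E : Type*} [NormedAddCommGroup E] [NormedSpace ℝ E]

theorem exists_isSolutionArc_of_lipschitzOnWith [CompleteSpace E] {g : E → E} {ξ : E} {r M L : ℝ≥0}
    (hM : ∀ η ∈ Metric.closedBall ξ r, ‖g η‖ ≤ M) (hL : LipschitzOnWith L g (Metric.closedBall ξ r))
    {τ : ℝ} (hτ : 0 ≤ τ) (hMτ : M * τ ≤ r) :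
    ∃ x : ℝ → E, x 0 = ξ ∧ IsSolutionArc g x 0 τ ∧ MapsTo x (Icc 0 τ) (Metric.closedBall ξ r) := by
  have hpl : IsPicardLindelof (fun _ => g) (tmin := 0) (tmax := τ) ⟨0, le_rfl, hτ⟩ ξ r 0 M L := by
    refine IsPicardLindelof.of_time_independent hM hL ?_
    simpa [max_eq_left hτ] using hMτ
  obtain ⟨x, hx⟩ := ODE.FunSpace.exists_isFixedPt_next hpl (Metric.mem_closedBall_self le_rfl)
  have hmem : ∀ t, x.compProj t ∈ Metric.closedBall ξ r := fun t =>
    x.compProj_mem_closedBall hpl.mul_max_le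
  have hpic : EqOn x.compProj (ODE.picard (fun _ => g) 0 ξ x.compProj) (Icc 0 τ) := fun t ht => by
    nth_rw 1 [← hx]
    rw [ODE.FunSpace.compProj_of_mem ht, ODE.FunSpace.next_apply]
  have hderiv : ∀ t ∈ Icc 0 τ, HasDerivWithinAt x.compProj (g (x.compProj t)) (Icc 0 τ) t :=
    fun t ht => (ODE.hasDerivWithinAt_picard_Icc (left_mem_Icc.2 hτ) hpl.continuousOn_uncurry
      x.continuous_compProj.continuousOn (fun s _ => hmem s) ξ ht).congr_of_mem hpic ht
  refine ⟨x.compProj, ?_, ⟨x.continuous_compProj.continuousOn, fun t ht => ?_⟩, fun t _ => hmem t⟩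
  · rw [hpic (left_mem_Icc.2 hτ), ODE.picard_apply₀]
  · exact (hderiv t (Ioo_subset_Icc_self ht)).hasDerivAt (Icc_mem_nhds ht.1 ht.2)

theorem exists_isSolutionArc_of_continuous [FiniteDimensional ℝ E] {g : E → E} (hg : Continuous g)
    (ξ : E) : ∃ (τ : ℝ) (x : ℝ → E), 0 < τ ∧ x 0 = ξ ∧ IsSolutionArc g x 0 τ := by
  have : ProperSpace E := FiniteDimensional.proper ℝ E
  have hK : IsCompact (Metric.closedBall ξ 1) := isCompact_closedBall ξ 1
  obtain ⟨M, hM⟩ := hK.exists_bound_of_continuousOn hg.continuousOn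
  have hM0 : 0 ≤ M := (norm_nonneg _).trans (hM ξ (Metric.mem_closedBall_self zero_le_one))
  have happrox : ∀ k : ℕ, ∃ G : E → E, ContDiff ℝ 1 G ∧ ∀ η, dist (G η) (g η) < 1 / ((k : ℝ) + 1) :=
    fun k => by
      obtain ⟨G, hGc, hGg, -⟩ := hg.exists_contDiff_approx (ε := fun _ => 1 / ((k : ℝ) + 1)) 1
        continuous_const fun _ => by positivity
      exact ⟨G, hGc, hGg⟩
  choose G hGc hGg using happrox
  have hGM : ∀ k, ∀ η ∈ Metric.closedBall ξ 1, ‖G k η‖ ≤ M + 1 := fun k η hη => by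
    have hk : 1 / ((k : ℝ) + 1) ≤ 1 := div_le_one_of_le₀ (by simp) (by positivity)
    linarith [hM η hη, hGg k η, norm_le_norm_add_norm_sub' (G k η) (g η),
      dist_eq_norm (G k η) (g η)]
  obtain ⟨τ, hτ, hMτ⟩ : ∃ τ : ℝ, 0 < τ ∧ (M + 1) * τ = 1 :=
    ⟨(M + 1)⁻¹, by positivity, mul_inv_cancel₀ (by positivity)⟩
  lift M + 1 to ℝ≥0 using by positivity with N hN
  have hsol : ∀ k, ∃ x : ℝ → E, x 0 = ξ ∧ IsSolutionArc (G k) x 0 τ ∧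
      MapsTo x (Icc 0 τ) (Metric.closedBall ξ 1) := fun k => by
    obtain ⟨L, hL⟩ :=
      (hGc k).contDiffOn.exists_lipschitzOnWith one_ne_zero (convex_closedBall ξ 1) hK
    exact exists_isSolutionArc_of_lipschitzOnWith (r := 1) (hGM k) hL hτ.le hMτ.le
  choose x hx0 hx hxK using hsol
  have hGu : TendstoUniformlyOn G g atTop (Metric.closedBall ξ 1) := by
    rw [Metric.tendstoUniformlyOn_iff]
    intro ε hε
    filter_upwards [(tendsto_order.1 (tendsto_one_div_add_atTop_nhds_zero_nat (𝕜 := ℝ))).2 ε hε]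
      with k hk η _
    exact (dist_comm _ _).trans_lt ((hGg k η).trans hk)
  obtain ⟨φ, y, -, hy, hlim⟩ :=
    IsSolutionArc.exists_subseq_tendsto hK hg.continuousOn hGu hGM hx hxK
  refine ⟨τ, y, hτ, tendsto_nhds_unique (hlim 0 (left_mem_Icc.2 hτ.le)) ?_, hy⟩
  simp only [hx0, tendsto_const_nhds]

end Peano

section Signals

theorem exists_isLeast_eq_of_continuousWithinAt_Ici {Γ : Type*} [TopologicalSpace Γ]
    [DiscreteTopology Γ] {σ : ℝ → Γ} {a b : ℝ}
    (hσ : ∀ t ∈ Icc a b, ContinuousWithinAt σ (Ici t) t) (hab : a ≤ b) :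
    ∃ r, IsLeast {t ∈ Icc a b | σ t = σ b} r := by
  have hne : {t ∈ Icc a b | σ t = σ b}.Nonempty := ⟨b, right_mem_Icc.2 hab, rfl⟩
  have hbdd : BddBelow {t ∈ Icc a b | σ t = σ b} := ⟨a, fun t ht => ht.1.1⟩
  set r := sInf {t ∈ Icc a b | σ t = σ b}
  have hr : r ∈ Icc a b :=
    ⟨le_csInf hne fun t ht => ht.1.1, csInf_le hbdd ⟨right_mem_Icc.2 hab, rfl⟩⟩
  obtain ⟨c, hrc, hc⟩ := mem_nhdsGE_iff_exists_Ico_subset.1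
    ((hσ r hr).eventually_mem ((isOpen_discrete {σ r}).mem_nhds (mem_singleton _)))
  obtain ⟨t, ht, htc⟩ := exists_lt_of_csInf_lt hne (mem_Ioi.1 hrc)
  exact ⟨r, ⟨hr, (hc ⟨csInf_le hbdd ht, htc⟩ : σ t = σ r).symm.trans ht.2⟩,
    fun t ht => csInf_le hbdd ht⟩

theorem le_iterate_card_of_forall_eq_imp_le {Γ β : Type*} [TopologicalSpace Γ] [DiscreteTopology Γ]
    [Preorder β] [TopologicalSpace β] [OrderClosedTopology β] {σ : ℝ → Γ} {u : ℝ → β} {α : β → β}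
    (hα : Monotone α) (hid : id ≤ α) {a b : ℝ}
    (hσ : ∀ t ∈ Icc a b, ContinuousWithinAt σ (Ici t) t) (hu : ContinuousOn u (Icc a b))
    (hle : ∀ r ∈ Icc a b, ∀ t ∈ Icc a b, r ≤ t → σ r = σ t → u t ≤ α (u r)) (S : Finset Γ)
    {t : ℝ} (ht : t ∈ Icc a b) (hS : ∀ s ∈ Icc a t, σ s ∈ S) : u t ≤ α^[S.card] (u a) := by
  classical
  induction S using Finset.strongInduction generalizing t with | H S ih =>
  have htS : σ t ∈ S := hS t (right_mem_Icc.2 ht.1)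
  obtain ⟨r, ⟨hr, hrt⟩, hmin⟩ := exists_isLeast_eq_of_continuousWithinAt_Ici
    (fun s hs => hσ s ⟨hs.1, hs.2.trans ht.2⟩) ht.1
  have hrb : r ∈ Icc a b := ⟨hr.1, hr.2.trans ht.2⟩
  rw [← Finset.card_erase_add_one htS, Function.iterate_succ_apply']
  refine (hle r hrb t ht hr.2 hrt).trans (hα ?_)
  rcases hr.1.eq_or_lt with rfl | har
  · exact Function.id_le_iterate_of_id_le hid _ _
  -- The mode `σ t` is not active before `r`, so the induction hypothesis applies up to `r`.
  have hbefore : ∀ s ∈ Ico a r, u s ≤ α^[(S.erase (σ t)).card] (u a) := fun s hs => by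
    refine ih _ (Finset.erase_ssubset htS) ⟨hs.1, hs.2.le.trans hrb.2⟩ fun w hw => ?_
    have hwt : w ∈ Icc a t := ⟨hw.1, hw.2.trans (hs.2.le.trans hr.2)⟩
    exact Finset.mem_erase.2
      ⟨fun hwσ => (hmin ⟨hwt, hwσ⟩).not_gt (hw.2.trans_lt hs.2), hS w hwt⟩
  have hlim : Tendsto u (𝓝[<] r) (𝓝 (u r)) :=
    (hu r hrb).mono_left (nhdsWithin_le_of_mem
      (mem_of_superset (Ico_mem_nhdsLT har) fun s hs => ⟨hs.1, hs.2.le.trans hrb.2⟩))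
  exact le_of_tendsto hlim (mem_of_superset (Ico_mem_nhdsLT har) hbefore)

variable {m : ℕ} {σ : ℝ → Fin m} {a b t : ℝ}

/-- Dwell intervals of a signal: `σ` does not switch between the times `a` and `b`, though it may do
so at either of them. -/
structure IsDwellInterval (σ : ℝ → Fin m) (a b : ℝ) : Prop where
  nonneg : 0 ≤ a
  notMem_discontinuities : ∀ t ∈ Ioo a b, t ∉ discontinuities σ

/-- Persistent dwell-time: every window of length `L` contains a dwell interval of length `τ`. An
average dwell-time implies it, and it suffices for asymptotic stability. -/
def HasPersistentDwellTime (τ L : ℝ) (σ : ℝ → Fin m) : Prop :=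
  ∀ a, 0 ≤ a → ∃ b, a ≤ b ∧ b + τ ≤ a + L ∧ IsDwellInterval σ b (b + τ)

theorem IsDwellInterval.mono {c d : ℝ} (h : IsDwellInterval σ a b) (hac : a ≤ c) (hdb : d ≤ b) :
    IsDwellInterval σ c d :=
  ⟨h.nonneg.trans hac, fun t ht => h.notMem_discontinuities t (Ioo_subset_Ioo hac hdb ht)⟩

theorem continuousAt_of_notMem_discontinuities (ht : 0 < t) (h : t ∉ discontinuities σ) :
    ContinuousAt σ t := by
  by_contra hc
  exact h ⟨ht, hc⟩

theorem notMem_switchingTimes (ht : 0 < t) (h : t ∉ discontinuities σ) : t ∉ switchingTimes σ := by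
  simp [switchingTimes, ht.ne', h]

theorem nonneg_of_mem_switchingTimes (h : t ∈ switchingTimes σ) : 0 ≤ t := by
  rcases h with rfl | h
  · exact le_rfl
  · exact h.1.le

namespace IsSwitchingSignal

theorem eq_of_mem_Ico (hσ : IsSwitchingSignal σ) (h : IsDwellInterval σ a b) (ht : t ∈ Ico a b) :
    σ t = σ a := by
  refine isPreconnected_Icc.constant (s := Icc a t) (f := σ) (fun u hu => ?_)
    (right_mem_Icc.2 ht.1) (left_mem_Icc.2 ht.1)
  rcases hu.1.eq_or_lt with rfl | hau
  · exact (hσ.right_continuous _ h.nonneg).mono Icc_subset_Ici_self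
  · exact (continuousAt_of_notMem_discontinuities (h.nonneg.trans_lt hau)
      (h.notMem_discontinuities u ⟨hau, hu.2.trans_lt ht.2⟩)).continuousWithinAt

theorem eq_of_mem_Icc (hσ : IsSwitchingSignal σ) (h : IsDwellInterval σ a b) (ht : t ∈ Icc a b)
    (htd : t ∉ discontinuities σ) : σ t = σ a := by
  rcases ht.1.eq_or_lt with rfl | hat
  · rfl
  have heq : ∀ᶠ u in 𝓝[<] t, σ u = σ t :=
    nhdsWithin_le_nhds ((continuousAt_of_notMem_discontinuities (h.nonneg.trans_lt hat)
      htd).eventually_mem ((isOpen_discrete {σ t}).mem_nhds (mem_singleton _)))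
  obtain ⟨u, hut, hu⟩ := (heq.and (Ico_mem_nhdsLT hat)).exists
  rw [← hut]
  exact hσ.eq_of_mem_Ico h ⟨hu.1, hu.2.trans_le ht.2⟩

theorem finite_switchingTimes_inter_Iic (hσ : IsSwitchingSignal σ) (T : ℝ) :
    (switchingTimes σ ∩ Iic T).Finite := by
  rw [switchingTimes, insert_eq, union_inter_distrib_right]
  exact ((finite_singleton 0).inter_of_left _).union (hσ.locally_finite T)

theorem eventually_notMem_discontinuities (hσ : IsSwitchingSignal σ) (T : ℝ) :
    ∀ᶠ t in 𝓝[≠] T, t ∉ discontinuities σ := by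
  have hfin : ((discontinuities σ ∩ Iic (T + 1)) \ {T}).Finite := (hσ.locally_finite _).sdiff
  have hnear : ∀ᶠ t in 𝓝 T, t ∉ (discontinuities σ ∩ Iic (T + 1)) \ {T} :=
    hfin.isClosed.isOpen_compl.mem_nhds (by simp)
  filter_upwards [nhdsWithin_le_nhds hnear, nhdsWithin_le_nhds (Iic_mem_nhds (lt_add_one T)),
    self_mem_nhdsWithin] with t ht htT hne hd
  exact ht ⟨⟨hd, htT⟩, hne⟩

theorem exists_isDwellInterval_left (hσ : IsSwitchingSignal σ) (hb : 0 < b) :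
    ∃ a, 0 < a ∧ a < b ∧ IsDwellInterval σ a b := by
  obtain ⟨c, hcb, hc⟩ := (mem_nhdsLT_iff_exists_Ioo_subset' hb).1
    ((hσ.eventually_notMem_discontinuities b).filter_mono
      (nhdsWithin_mono _ fun t ht => ne_of_lt ht))
  obtain ⟨a, hca, hab⟩ := exists_between (max_lt hb hcb)
  exact ⟨a, (le_max_left _ _).trans_lt hca, hab, ((le_max_left _ _).trans_lt hca).le,
    fun t ht => hc ⟨((le_max_right _ _).trans_lt hca).trans ht.1, ht.2⟩⟩

theorem exists_isDwellInterval_right (hσ : IsSwitchingSignal σ) (ha : 0 ≤ a) :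
    ∃ b, a < b ∧ IsDwellInterval σ a b := by
  obtain ⟨b, hab, hb⟩ := (mem_nhdsGT_iff_exists_Ioo_subset' (lt_add_one a)).1
    ((hσ.eventually_notMem_discontinuities a).filter_mono
      (nhdsWithin_mono _ fun t ht => ne_of_gt ht))
  exact ⟨b, hab, ha, fun t ht => hb ht⟩

theorem exists_isGreatest_switchingTimes (hσ : IsSwitchingSignal σ) (ht : 0 ≤ t) :
    ∃ s, IsGreatest (switchingTimes σ ∩ Iic t) s := by
  obtain ⟨s, hs, hmax⟩ := (hσ.finite_switchingTimes_inter_Iic t).exists_maximalFor id _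
    ⟨0, mem_insert _ _, ht⟩
  exact ⟨s, hs, fun r hr => le_of_not_gt fun h => h.not_ge (hmax hr h.le)⟩

theorem exists_isLeast_switchingTimes (hσ : IsSwitchingSignal σ) {s r : ℝ}
    (hr : r ∈ switchingTimes σ) (hsr : s < r) :
    ∃ s', IsLeast {r | r ∈ switchingTimes σ ∧ s < r} s' := by
  have hfin : ({r | r ∈ switchingTimes σ ∧ s < r} ∩ Iic r).Finite :=
    (hσ.finite_switchingTimes_inter_Iic r).subset fun u hu => ⟨hu.1.1, hu.2⟩
  obtain ⟨s', hs', hmin⟩ := hfin.exists_minimalFor id _ ⟨r, ⟨hr, hsr⟩, mem_Iic.2 le_rfl⟩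
  refine ⟨s', hs'.1, fun u hu => le_of_not_gt fun h => ?_⟩
  exact h.not_ge (hmin ⟨hu, h.le.trans hs'.2⟩ h.le)

end IsSwitchingSignal

theorem isDwellInterval_of_isGreatest {s : ℝ} (hs : IsGreatest (switchingTimes σ ∩ Iic t) s) :
    IsDwellInterval σ s t :=
  ⟨nonneg_of_mem_switchingTimes hs.1.1,
    fun _ hu hud => (hs.2 ⟨mem_insert_of_mem _ hud, hu.2.le⟩).not_gt hu.1⟩

theorem isDwellInterval_of_isLeast {s s' : ℝ} (hs : 0 ≤ s)
    (hs' : IsLeast {r | r ∈ switchingTimes σ ∧ s < r} s') : IsDwellInterval σ s s' :=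
  ⟨hs, fun _ hu hud => (hs'.2 ⟨mem_insert_of_mem _ hud, hu.1⟩).not_gt hu.2⟩

theorem IsSwitchingSignal.eq_of_isGreatest (hσ : IsSwitchingSignal σ) {s : ℝ}
    (hs : IsGreatest (switchingTimes σ ∩ Iic t) s) : σ t = σ s := by
  rcases (mem_Iic.1 hs.1.2).eq_or_lt with rfl | hst
  · rfl
  · exact hσ.eq_of_mem_Icc (isDwellInterval_of_isGreatest hs) (right_mem_Icc.2 hst.le)
      fun htd => (hs.2 ⟨mem_insert_of_mem _ htd, self_mem_Iic⟩).not_gt hst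

theorem IsSwitchingSignal.exists_isDwellInterval_of_ncard_lt (hσ : IsSwitchingSignal σ) (ha : 0 ≤ a)
    {τ : ℝ} (hτ : 0 ≤ τ) {N : ℕ} (h : (switchingTimes σ ∩ Ioo a (a + N * τ)).ncard < N) :
    ∃ i < N, IsDwellInterval σ (a + i * τ) (a + i * τ + τ) := by
  by_contra! hcon
  have hpart : ∀ i : Fin N, a ≤ a + i * τ ∧ a + i * τ + τ ≤ a + N * τ := fun i => by
    have hi : ((i : ℕ) : ℝ) + 1 ≤ N := by exact_mod_cast i.2
    exact ⟨le_add_of_nonneg_right (by positivity), by nlinarith⟩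
  have hex : ∀ i : Fin N, ∃ u ∈ Ioo (a + i * τ) (a + i * τ + τ), u ∈ discontinuities σ :=
    fun i => by
      by_contra! hno
      exact hcon i i.2 ⟨ha.trans (hpart i).1, hno⟩
  choose u hu hud using hex
  have hmono : StrictMono u := fun i j hij => by
    have hij' : ((i : ℕ) : ℝ) + 1 ≤ (j : ℕ) := by exact_mod_cast hij
    nlinarith [(hu i).2, (hu j).1]
  have hsub : range u ⊆ switchingTimes σ ∩ Ioo a (a + N * τ) := by
    rintro _ ⟨i, rfl⟩
    exact ⟨mem_insert_of_mem _ (hud i), (hpart i).1.trans_lt (hu i).1,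
      (hu i).2.trans_le (hpart i).2⟩
  have hfin : (switchingTimes σ ∩ Ioo a (a + N * τ)).Finite :=
    (hσ.finite_switchingTimes_inter_Iic _).subset fun t ht => ⟨ht.1, ht.2.2.le⟩
  have hcard := ncard_le_ncard hsub hfin
  rw [ncard_range_of_injective hmono.injective, Nat.card_fin] at hcard
  exact h.not_ge hcard

theorem HasPersistentDwellTime.exists_seq {τ L t₀ : ℝ} (h : HasPersistentDwellTime τ L σ)
    (hτ : 0 ≤ τ) (ht₀ : 0 ≤ t₀) :
    ∃ b : ℕ → ℝ, (∀ i, t₀ ≤ b i) ∧ (∀ i, IsDwellInterval σ (b i) (b i + τ)) ∧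
      (∀ i j, i < j → b i + τ ≤ b j) ∧ ∀ i k : ℕ, i < k → b i + τ ≤ t₀ + k * L := by
  have hL : 0 ≤ L := by
    obtain ⟨b, hb, hbL, -⟩ := h 0 le_rfl
    linarith
  choose b hab hbL hb using fun i : ℕ => h (t₀ + i * L) (by positivity)
  have hend : ∀ i k : ℕ, i < k → b i + τ ≤ t₀ + k * L := fun i k hik => by
    have hik' : ((i : ℝ) + 1) * L ≤ k * L := by gcongr; exact_mod_cast hik
    linarith [hbL i]
  exact ⟨b, fun i => (le_add_of_nonneg_right (by positivity)).trans (hab i), hb,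
    fun i j hij => (hend i j hij).trans (hab j), hend⟩

theorem HasAverageDwellTime.hasPersistentDwellTime {τD : ℝ} {N0 : ℕ}
    (h : HasAverageDwellTime τD N0 σ) (hσ : IsSwitchingSignal σ) (hτD : 0 < τD) :
    HasPersistentDwellTime (τD / (N0 + 2)) τD σ := by
  intro a ha
  have hτ : 0 < τD / (N0 + 2) := by positivity
  have hN : ((N0 + 2 : ℕ) : ℝ) * (τD / (N0 + 2)) = τD := by
    push_cast
    field_simp
  -- At most `N0 + 1` switches in a window of length `τD` leave one of its `N0 + 2` parts free.
  have hcard : (switchingTimes σ ∩ Ioo a (a + (N0 + 2 : ℕ) * (τD / (N0 + 2)))).ncard < N0 + 2 := by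
    have hle := h a (a + τD) ha (lt_add_of_pos_right a hτD)
    rw [add_sub_cancel_left, div_self hτD.ne'] at hle
    rw [hN]
    exact Nat.lt_succ_of_le (by exact_mod_cast hle)
  obtain ⟨i, hi, hdwell⟩ := hσ.exists_isDwellInterval_of_ncard_lt ha hτ.le hcard
  have hi' : (i : ℝ) + 1 ≤ (N0 + 2 : ℕ) := by exact_mod_cast hi
  exact ⟨_, le_add_of_nonneg_right (by positivity), by nlinarith, hdwell⟩

end Signals

section Continuation

theorem IsTimeInterval.nonneg {I : Set ℝ} (hI : IsTimeInterval I) {t : ℝ} (ht : t ∈ I) :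
    0 ≤ t := by
  rcases hI with rfl | ⟨T, -, rfl | rfl⟩
  exacts [ht, ht.1, ht.1]

theorem IsTimeInterval.mem_of_le {I : Set ℝ} (hI : IsTimeInterval I) {s t : ℝ} (ht : t ∈ I)
    (hs : 0 ≤ s) (hst : s ≤ t) : s ∈ I := by
  rcases hI with rfl | ⟨T, -, rfl | rfl⟩
  exacts [hs, ⟨hs, hst.trans_lt ht.2⟩, ⟨hs, hst.trans ht.2⟩]

variable {n m : ℕ} {f : Fin m → EuclideanSpace ℝ (Fin n) → EuclideanSpace ℝ (Fin n)}
  {σ : ℝ → Fin m} {x : ℝ → EuclideanSpace ℝ (Fin n)} {I : Set ℝ} {a b : ℝ}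

namespace IsSolution

theorem mono (hx : IsSolution f σ x I) {J : Set ℝ} (hJ : IsTimeInterval J) (hJI : J ⊆ I) :
    IsSolution f σ x J :=
  ⟨hJ, hx.continuousOn.mono hJI, fun t ht hts => (hx.ode t (hJI ht) hts).mono hJI⟩

theorem congr (hx : IsSolution f σ x I) {y : ℝ → EuclideanSpace ℝ (Fin n)} (hy : EqOn y x I) :
    IsSolution f σ y I := by
  refine ⟨hx.interval, hx.continuousOn.congr hy, fun t ht hts => ?_⟩
  rw [hy ht]
  exact (hx.ode t ht hts).congr_of_mem hy ht

theorem isSolutionArc (hσ : IsSwitchingSignal σ) (hx : IsSolution f σ x I)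
    (hab : IsDwellInterval σ a b) (hb : b ∈ I) : IsSolutionArc (f (σ a)) x a b := by
  have hsub : Icc a b ⊆ I := fun s hs => hx.interval.mem_of_le hb (hab.nonneg.trans hs.1) hs.2
  refine ⟨hx.continuousOn.mono hsub, fun t ht => ?_⟩
  have hode := hx.ode t (hsub (Ioo_subset_Icc_self ht))
    (notMem_switchingTimes (hab.nonneg.trans_lt ht.1) (hab.notMem_discontinuities t ht))
  rw [hσ.eq_of_mem_Ico hab ⟨ht.1.le, ht.2⟩] at hode
  exact hode.hasDerivAt (mem_of_superset (Icc_mem_nhds ht.1 ht.2) hsub)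

theorem append (hf : ∀ γ, Continuous (f γ)) (hσ : IsSwitchingSignal σ) (ha : 0 < a) (hab : a < b)
    (hdwell : IsDwellInterval σ a b) (hx : IsSolution f σ x (Icc 0 a))
    (harc : IsSolutionArc (f (σ a)) x a b) : IsSolution f σ x (Icc 0 b) := by
  have hunion : Icc 0 a ∪ Icc a b = Icc 0 b := Icc_union_Icc_eq_Icc ha.le hab.le
  refine ⟨Or.inr ⟨b, ha.trans hab, Or.inr rfl⟩, ?_, fun t _ hts => ?_⟩
  · rw [← hunion]
    exact hx.continuousOn.union_of_isClosed harc.continuousOn isClosed_Icc isClosed_Icc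
  have hleft : HasDerivWithinAt x (f (σ t) (x t)) (Icc 0 a) t := by
    by_cases hta : t ∈ Icc 0 a
    · exact hx.ode t hta hts
    · exact hasDerivWithinAt_iff_hasFDerivWithinAt.2 (.of_notMem_closure (by rwa [closure_Icc]))
  have hright : HasDerivWithinAt x (f (σ t) (x t)) (Icc a b) t := by
    by_cases htb : t ∈ Icc a b
    · rw [hσ.eq_of_mem_Icc hdwell htb fun h => hts (mem_insert_of_mem _ h)]
      exact harc.hasDerivWithinAt (hf _) hab htb
    · exact hasDerivWithinAt_iff_hasFDerivWithinAt.2 (.of_notMem_closure (by rwa [closure_Icc]))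
  rw [← hunion]
  exact hleft.union hright

theorem exists_extension_Icc_of_bounded (hf : ∀ γ, Continuous (f γ)) (hσ : IsSwitchingSignal σ)
    {T R : ℝ} (hT : 0 < T) (hx : IsSolution f σ x (Ico 0 T)) (hR : ∀ t ∈ Ico 0 T, ‖x t‖ ≤ R) :
    ∃ y, IsSolution f σ y (Icc 0 T) ∧ EqOn x y (Ico 0 T) := by
  obtain ⟨a, ha, haT, hdwell⟩ := hσ.exists_isDwellInterval_left hT
  have hxK : MapsTo x (Ioo a T) (Metric.closedBall 0 R) := fun t ht =>
    mem_closedBall_zero_iff.2 (hR t ⟨(ha.trans ht.1).le, ht.2⟩)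
  have hxd : ∀ t ∈ Ioo a T, HasDerivAt x (f (σ a) (x t)) t := fun t ht => by
    obtain ⟨c, htc, hcT⟩ := exists_between ht.2
    exact (hx.isSolutionArc hσ (hdwell.mono le_rfl hcT.le)
      ⟨(ha.trans (ht.1.trans htc)).le, hcT⟩).hasDerivAt t ⟨ht.1, htc⟩
  obtain ⟨ℓ, hℓ⟩ := exists_isSolutionArc_update haT (isCompact_closedBall _ _)
    (hf (σ a)).continuousOn (hx.continuousOn.mono fun t ht => ⟨ha.le.trans ht.1, ht.2⟩) hxd hxK
  have heq : EqOn (Function.update x T ℓ) x (Iio T) := fun t ht => Function.update_of_ne ht.ne _ _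
  have hxa : IsSolution f σ x (Icc 0 a) :=
    hx.mono (Or.inr ⟨a, ha, Or.inr rfl⟩) fun t ht => ⟨ht.1, ht.2.trans_lt haT⟩
  exact ⟨Function.update x T ℓ,
    append hf hσ ha haT hdwell (hxa.congr fun t ht => heq (ht.2.trans_lt haT)) hℓ,
    fun t ht => (heq ht.2).symm⟩

theorem exists_extension_Icc_of_Icc (hf : ∀ γ, Continuous (f γ)) (hσ : IsSwitchingSignal σ)
    {T : ℝ} (hT : 0 < T) (hx : IsSolution f σ x (Icc 0 T)) :
    ∃ y T', T < T' ∧ IsSolution f σ y (Icc 0 T') ∧ EqOn x y (Icc 0 T) := by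
  obtain ⟨b, hTb, hdwell⟩ := hσ.exists_isDwellInterval_right hT.le
  obtain ⟨τ, z, hτ, hz0, hz⟩ := exists_isSolutionArc_of_continuous (hf (σ T)) (x T)
  obtain ⟨T', hTT', hT'⟩ := exists_between (lt_min hTb (lt_add_of_pos_right T hτ))
  have hzT : IsSolutionArc (f (σ T)) (fun t => z (t + -T)) T T' :=
    (hz.comp_add_const (-T)).mono (by simp) (by linarith [hT'.trans_le (min_le_right _ _)])
  let y : ℝ → EuclideanSpace ℝ (Fin n) := fun t => if t ≤ T then x t else z (t + -T)
  have hyx : EqOn y x (Iic T) := fun t ht => if_pos ht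
  have hyz : EqOn y (fun t => z (t + -T)) (Ici T) := fun t ht => by
    rcases (mem_Ici.1 ht).eq_or_lt with rfl | h
    · simp [hyx self_mem_Iic, hz0]
    · exact if_neg h.not_ge
  exact ⟨y, T', hTT', append hf hσ hT hTT'
    (hdwell.mono le_rfl (hT'.trans_le (min_le_left _ _)).le)
    (hx.congr fun t ht => hyx ht.2) (hzT.congr fun t ht => hyz ht.1),
    fun t ht => (hyx ht.2).symm⟩

end IsSolution

theorem IsMaximalSolution.eq_Ici_of_bounded (hf : ∀ γ, Continuous (f γ))
    (hσ : IsSwitchingSignal σ) {R : ℝ} (hx : IsMaximalSolution f σ x I)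
    (hR : ∀ t ∈ I, ‖x t‖ ≤ R) : I = Ici 0 := by
  rcases hx.1.interval with h | ⟨T, hT, rfl | rfl⟩
  · exact h
  · obtain ⟨y, hy, hxy⟩ := hx.1.exists_extension_Icc_of_bounded hf hσ hT hR
    have hT' : T ∈ Ico 0 T := hx.2 y _ hy Ico_subset_Icc_self hxy ▸ right_mem_Icc.2 hT.le
    exact absurd hT'.2 (lt_irrefl T)
  · obtain ⟨y, T', hTT', hy, hxy⟩ := hx.1.exists_extension_Icc_of_Icc hf hσ hT
    have hT' : T' ∈ Icc 0 T :=
      hx.2 y _ hy (Icc_subset_Icc_right hTT'.le) hxy ▸ right_mem_Icc.2 (hT.trans hTT').le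
    exact absurd hT'.2 hTT'.not_ge

end Continuation

section ComparisonFunctions

theorem isClassKInfty_id : IsClassKInfty fun r => r :=
  ⟨strictMono_id, continuous_id, rfl, fun M => ⟨M + 1, lt_add_one M⟩⟩

namespace IsClassKInfty

variable {α β : ℝ≥0 → ℝ≥0}

theorem comp (hα : IsClassKInfty α) (hβ : IsClassKInfty β) : IsClassKInfty (α ∘ β) := by
  refine ⟨hα.strictMono.comp hβ.strictMono, hα.continuous.comp hβ.continuous, ?_, fun M => ?_⟩
  · simp [hα.map_zero, hβ.map_zero]
  · obtain ⟨s, hs⟩ := hα.unbounded M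
    obtain ⟨r, hr⟩ := hβ.unbounded s
    exact ⟨r, hs.trans (hα.strictMono hr)⟩

theorem iterate (hα : IsClassKInfty α) (k : ℕ) : IsClassKInfty α^[k] := by
  induction k with
  | zero => exact isClassKInfty_id
  | succ k ih => exact ih.comp hα

theorem add_monotone (hα : IsClassKInfty α) (hβ : Monotone β) (hc : Continuous β) (h0 : β 0 = 0) :
    IsClassKInfty fun r => α r + β r where
  strictMono := hα.strictMono.add_monotone hβ
  continuous := hα.continuous.add hc
  map_zero := by simp [hα.map_zero, h0]
  unbounded M := (hα.unbounded M).imp fun _ hs => hs.trans_le le_self_add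

theorem surjective (hα : IsClassKInfty α) : Function.Surjective α := by
  intro r
  obtain ⟨s, hs⟩ := hα.unbounded r
  obtain ⟨u, -, hu⟩ := intermediate_value_Icc (zero_le : 0 ≤ s) hα.continuous.continuousOn
    ⟨by simp [hα.map_zero], hs.le⟩
  exact ⟨u, hu⟩

theorem exists_rightInverse (hα : IsClassKInfty α) :
    ∃ β, IsClassKInfty β ∧ Function.RightInverse β α := by
  let e := StrictMono.orderIsoOfSurjective α hα.strictMono hα.surjective
  have he : Function.RightInverse e.symm α := e.apply_symm_apply
  refine ⟨e.symm, ⟨e.symm.strictMono, e.symm.continuous, ?_, fun M => ⟨α (M + 1), ?_⟩⟩, he⟩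
  · exact hα.strictMono.injective ((he 0).trans hα.map_zero.symm)
  · exact (lt_add_one M).trans_eq (e.symm_apply_apply (M + 1)).symm

end IsClassKInfty

end ComparisonFunctions

section WeakLyapunov

variable {n m : ℕ} {f : Fin m → EuclideanSpace ℝ (Fin n) → EuclideanSpace ℝ (Fin n)}
  {χ : Fin m → Set (EuclideanSpace ℝ (Fin n))} {p : Trajectory f}

theorem Trajectory.mapsTo_of_isDwellInterval {γ : Fin m} {a b : ℝ} (hχ : IsClosed (χ γ))
    (hp : ∀ t ∈ p.dom, p.state t ∈ χ (p.signal t)) (hab : IsDwellInterval p.signal a b)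
    (hb : b ∈ p.dom) (hγ : p.signal a = γ) : MapsTo p.state (Icc a b) (χ γ) := by
  have hdom : Icc a b ⊆ p.dom := fun s hs =>
    p.isSolution.interval.mem_of_le hb (hab.nonneg.trans hs.1) hs.2
  have hIco : MapsTo p.state (Ico a b) (χ γ) := fun t ht => by
    have ht' := hp t (hdom (Ico_subset_Icc_self ht))
    rwa [p.isSwitchingSignal.eq_of_mem_Ico hab ht, hγ] at ht'
  rcases lt_trichotomy a b with h | rfl | h
  · rw [← closure_Ico h.ne, ← hχ.closure_eq]
    refine hIco.closure_of_continuousOn ?_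
    rw [closure_Ico h.ne]
    exact p.isSolution.continuousOn.mono hdom
  · rw [Icc_self, mapsTo_singleton, ← hγ]
    exact hp a hb
  · rw [Icc_eq_empty h.not_ge]
    exact mapsTo_empty _ _

namespace IsWeakLyapunovLike

variable {T' : Set (Trajectory f)} {V : EuclideanSpace ℝ (Fin n) → Fin m → ℝ}

theorem mono (hV : IsWeakLyapunovLike χ T' V) {S : Set (Trajectory f)} (hS : S ⊆ T') :
    IsWeakLyapunovLike χ S V :=
  ⟨hV.contDiff, hV.bounds, hV.decreasing, fun p hp => hV.switching p (hS hp)⟩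

theorem nonneg (hV : IsWeakLyapunovLike χ T' V) {γ : Fin m} {ξ : EuclideanSpace ℝ (Fin n)}
    (hξ : ξ ∈ χ γ) : 0 ≤ V ξ γ := by
  obtain ⟨α₁, α₂, -, -, h⟩ := hV.bounds
  exact (α₁ _).coe_nonneg.trans (h γ ξ hξ).1

variable (hV : IsWeakLyapunovLike χ T' V) (hχ : ∀ γ, IsClosed (χ γ))
include hV hχ

theorem antitoneOn (hp : ∀ t ∈ p.dom, p.state t ∈ χ (p.signal t)) {a b : ℝ}
    (hab : IsDwellInterval p.signal a b) (hb : b ∈ p.dom) :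
    AntitoneOn (fun t => V (p.state t) (p.signal a)) (Icc a b) :=
  (p.isSolution.isSolutionArc p.isSwitchingSignal hab hb).antitoneOn_comp
    ((hV.contDiff _).differentiable one_ne_zero) fun _ ht => hV.decreasing _ _
      (Trajectory.mapsTo_of_isDwellInterval (hχ _) hp hab hb rfl (Ioo_subset_Icc_self ht))

theorem le_of_signal_eq (hpT : p ∈ T') (hp : ∀ t ∈ p.dom, p.state t ∈ χ (p.signal t))
    {a a' b : ℝ} (haa' : a ≤ a') (ha'b : a' ≤ b) (hb : b ∈ p.dom)
    (hdwell : IsDwellInterval p.signal a a') (hσ : p.signal a = p.signal b) :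
    V (p.state b) (p.signal b) ≤ V (p.state a') (p.signal a) := by
  have hb0 : 0 ≤ b := p.isSolution.interval.nonneg hb
  obtain ⟨s, hs⟩ := p.isSwitchingSignal.exists_isGreatest_switchingTimes hdwell.nonneg
  obtain ⟨t, ht⟩ := p.isSwitchingSignal.exists_isGreatest_switchingTimes hb0
  have hsa : s ≤ a := hs.1.2
  have htb : t ≤ b := ht.1.2
  have hσs : p.signal a = p.signal s := p.isSwitchingSignal.eq_of_isGreatest hs
  have hσt : p.signal b = p.signal t := p.isSwitchingSignal.eq_of_isGreatest ht
  have hlast := hV.antitoneOn hχ hp (isDwellInterval_of_isGreatest ht) hb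
  simp only [← hσt] at hlast
  have hst : s ≤ t := ht.2 ⟨hs.1.1, hsa.trans (haa'.trans ha'b)⟩
  rcases hst.eq_or_lt with rfl | hst
  · rw [hσ]
    exact hlast ⟨hsa.trans haa', ha'b⟩ (right_mem_Icc.2 htb) ha'b
  obtain ⟨s', hs'⟩ := p.isSwitchingSignal.exists_isLeast_switchingTimes ht.1.1 hst
  have hs't : s' ≤ t := hs'.2 ⟨ht.1.1, hst⟩
  have has' : a < s' := lt_of_not_ge fun h => (hs.2 ⟨hs'.1.1, h⟩).not_gt hs'.1.2
  have ha's' : a' ≤ s' := le_of_not_gt fun h => hdwell.notMem_discontinuities s' ⟨has', h⟩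
    (hs'.1.1.resolve_left (hdwell.nonneg.trans_lt has').ne')
  have hfirst := hV.antitoneOn hχ hp
    (isDwellInterval_of_isLeast (nonneg_of_mem_switchingTimes hs.1.1) hs')
    (p.isSolution.interval.mem_of_le hb (hdwell.nonneg.trans has'.le) (hs't.trans htb))
  have htdom := p.isSolution.interval.mem_of_le hb (nonneg_of_mem_switchingTimes ht.1.1) htb
  calc V (p.state b) (p.signal b) ≤ V (p.state t) (p.signal b) :=
        hlast (left_mem_Icc.2 htb) (right_mem_Icc.2 htb) htb
    _ = V (p.state t) (p.signal t) := by rw [hσt]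
    _ ≤ V (p.state s') (p.signal s) :=
        hV.switching p hpT s s' t hs.1.1 ht.1.1 htdom hst hs' (hσs.symm.trans (hσ.trans hσt))
    _ ≤ V (p.state a') (p.signal s) :=
        hfirst ⟨hsa.trans haa', ha's'⟩ (right_mem_Icc.2 hs'.1.2.le) ha's'
    _ = V (p.state a') (p.signal a) := by rw [hσs]

-- `α = id + α₁⁻¹ ∘ α₂` bounds the growth from one activation of a mode to the next.
theorem exists_isClassKInfty_nnnorm_le : ∃ α, IsClassKInfty α ∧ ∀ p ∈ T',
    (∀ t ∈ p.dom, p.state t ∈ χ (p.signal t)) → ∀ t₀ t : ℝ, 0 ≤ t₀ → t₀ ≤ t → t ∈ p.dom →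
      ‖p.state t‖₊ ≤ α ‖p.state t₀‖₊ := by
  obtain ⟨α₁, α₂, hα₁, hα₂, hbd⟩ := hV.bounds
  obtain ⟨β, hβ, hαβ⟩ := hα₁.exists_rightInverse
  have hβα := hβ.comp hα₂
  have hα : IsClassKInfty fun r => r + (β ∘ α₂) r :=
    isClassKInfty_id.add_monotone hβα.strictMono.monotone hβα.continuous hβα.map_zero
  refine ⟨_, hα.iterate m, fun p hpT hp t₀ t ht₀ htt ht => ?_⟩
  have hdom : Icc t₀ t ⊆ p.dom := fun u hu =>
    p.isSolution.interval.mem_of_le ht (ht₀.trans hu.1) hu.2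
  have hgrowth : ∀ r ∈ Icc t₀ t, ∀ u ∈ Icc t₀ t, r ≤ u → p.signal r = p.signal u →
      ‖p.state u‖₊ ≤ ‖p.state r‖₊ + (β ∘ α₂) ‖p.state r‖₊ := fun r hr u hu hru hσ => by
    have hle := hV.le_of_signal_eq hχ hpT hp le_rfl hru (hdom hu)
      ⟨ht₀.trans hr.1, by simp⟩ hσ
    have hα₁₂ : α₁ ‖p.state u‖₊ ≤ α₂ ‖p.state r‖₊ := by
      exact_mod_cast (hbd _ _ (hp u (hdom hu))).1.trans (hle.trans (hbd _ _ (hp r (hdom hr))).2)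
    rw [← hαβ (α₂ _)] at hα₁₂
    exact (hα₁.strictMono.le_iff_le.1 hα₁₂).trans le_add_self
  have hfinal := le_iterate_card_of_forall_eq_imp_le hα.strictMono.monotone
    (fun r => le_self_add) (fun u hu => p.isSwitchingSignal.right_continuous u (ht₀.trans hu.1))
    (p.isSolution.continuousOn.mono hdom).nnnorm hgrowth Finset.univ (right_mem_Icc.2 htt)
    fun u _ => Finset.mem_univ _
  rwa [Finset.card_fin] at hfinal

theorem uniformlyStable (hf : ∀ γ, Continuous (f γ)) (hT : T' ⊆ coveringTrajectories f χ) :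
    UniformlyStable T' := by
  obtain ⟨α, hα, hle⟩ := hV.exists_isClassKInfty_nnnorm_le hχ
  refine ⟨α, hα, fun p hp => ?_⟩
  have hdom : p.dom = Ici 0 :=
    (hT hp).1.eq_Ici_of_bounded (R := α ‖p.state 0‖₊) hf p.isSwitchingSignal fun t ht => by
      exact_mod_cast hle p hp (hT hp).2 0 t le_rfl (p.isSolution.interval.nonneg ht) ht
  exact ⟨hdom, fun t₀ t h₁ h₂ => hle p hp (hT hp).2 t₀ t h₁ h₂ (hdom ▸ h₁.trans h₂)⟩

end IsWeakLyapunovLike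

end WeakLyapunov

section Dissipation

theorem mul_card_le_of_forall_lt_add_le {ι : Type*} [LinearOrder ι] {c : ℝ} {u : ι → ℝ}
    (S : Finset ι) {A : ℝ} (hA : 0 ≤ A) (hc : ∀ i ∈ S, c ≤ u i) (huA : ∀ i ∈ S, u i ≤ A)
    (hlt : ∀ i ∈ S, ∀ j ∈ S, i < j → u j + c ≤ u i) : c * S.card ≤ A := by
  induction S using Finset.induction_on_min generalizing A with
  | empty => simpa using hA
  | insert a S ha ih =>
    have haS : a ∉ S := fun h => lt_irrefl a (ha a h)
    simp only [Finset.forall_mem_insert] at hc huA hlt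
    have htail : c * S.card ≤ u a - c := ih (sub_nonneg.2 hc.1) hc.2
      (fun i hi => le_sub_iff_add_le.2 (hlt.1.2 i hi (ha i hi))) fun i hi => (hlt.2 i hi).2
    rw [Finset.card_insert_of_notMem haS]
    push_cast
    linarith [huA.1]

section Arcs

variable {n : ℕ} {g : EuclideanSpace ℝ (Fin n) → EuclideanSpace ℝ (Fin n)}
  {w v : EuclideanSpace ℝ (Fin n) → ℝ} {C : Set (EuclideanSpace ℝ (Fin n))} {τ : ℝ}

theorem ZeroSmallTimeDistinguishable.eq_zero_of_le (hd : ZeroSmallTimeDistinguishable g w)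
    (hw : Continuous w) (hw0 : ∀ ξ ∈ C, 0 ≤ w ξ) (hv : Differentiable ℝ v)
    (hvw : ∀ ξ ∈ C, fderiv ℝ v ξ (g ξ) ≤ -w ξ) {y : ℝ → EuclideanSpace ℝ (Fin n)}
    (hy : IsSolutionArc g y 0 τ) (hτ : 0 < τ) (hyC : MapsTo y (Icc 0 τ) C)
    (hle : v (y 0) ≤ v (y τ)) : y 0 = 0 := by
  have hyC' : ∀ t ∈ Ioo 0 τ, y t ∈ C := fun t ht => hyC (Ioo_subset_Icc_self ht)
  have hanti : AntitoneOn (fun t => v (y t)) (Icc 0 τ) := hy.antitoneOn_comp hv fun t ht =>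
    (hvw _ (hyC' t ht)).trans (neg_nonpos.2 (hw0 _ (hyC' t ht)))
  have hconst : ∀ t ∈ Icc 0 τ, v (y t) = v (y 0) := fun t ht =>
    le_antisymm (hanti (left_mem_Icc.2 hτ.le) ht ht.1)
      (hle.trans (hanti ht (right_mem_Icc.2 hτ.le) ht.2))
  have hw_Ioo : EqOn (fun t => w (y t)) 0 (Ioo 0 τ) := fun t ht => by
    have hderiv : HasDerivAt (fun s => v (y s)) 0 t := by
      refine (hasDerivAt_const t (v (y 0))).congr_of_eventuallyEq ?_
      filter_upwards [Icc_mem_nhds ht.1 ht.2] with s hs using hconst s hs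
    have hrate := hvw _ (hyC' t ht)
    rw [(hy.hasDerivAt_comp hv ht).unique hderiv] at hrate
    exact le_antisymm (neg_nonneg.1 hrate) (hw0 _ (hyC' t ht))
  have hw_Icc : EqOn (fun t => w (y t)) 0 (Icc 0 τ) :=
    hw_Ioo.of_subset_closure (hw.comp_continuousOn hy.continuousOn) continuousOn_const
      Ioo_subset_Icc_self (closure_Ioo hτ.ne).ge
  exact hd τ y hτ (hy.continuousOn.mono Ico_subset_Icc_self) hy.hasDerivAt
    fun t ht => hw_Icc (Ico_subset_Icc_self ht)

-- Otherwise solution arcs along which `v` drops by less and less accumulate at an arc along which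
-- `v` is constant, and this arc starts at `0` although it avoids `0`.
theorem ZeroSmallTimeDistinguishable.exists_pos_forall_add_le
    (hd : ZeroSmallTimeDistinguishable g w) (hg : Continuous g) (hw : Continuous w)
    (hw0 : ∀ ξ ∈ C, 0 ≤ w ξ) (hv : Differentiable ℝ v)
    (hvw : ∀ ξ ∈ C, fderiv ℝ v ξ (g ξ) ≤ -w ξ) (hC : IsCompact C) (h0 : 0 ∉ C) (hτ : 0 < τ) :
    ∃ c > 0, ∀ (x : ℝ → EuclideanSpace ℝ (Fin n)) (b : ℝ), IsSolutionArc g x b (b + τ) →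
      MapsTo x (Icc b (b + τ)) C → v (x (b + τ)) + c ≤ v (x b) := by
  by_contra! hcon
  choose z b hz hzC hlt using fun k : ℕ => hcon (1 / ((k : ℝ) + 1)) (by positivity)
  let x : ℕ → ℝ → EuclideanSpace ℝ (Fin n) := fun k t => z k (t + b k)
  have hx : ∀ k, IsSolutionArc g (x k) 0 τ := fun k =>
    ((hz k).comp_add_const (b k)).mono (by simp) (by simp)
  have hxC : ∀ k, MapsTo (x k) (Icc 0 τ) C := fun k t ht =>
    hzC k ⟨by linarith [ht.1], by linarith [ht.2]⟩
  obtain ⟨M, hM⟩ := hC.exists_bound_of_continuousOn hg.continuousOn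
  obtain ⟨φ, y, hφ, hy, hlim⟩ := IsSolutionArc.exists_subseq_tendsto (G := fun _ => g) hC
    hg.continuousOn (fun u hu => Eventually.of_forall fun _ ξ _ => refl_mem_uniformity hu)
    (fun _ ξ hξ => NNReal.le_toNNReal_of_coe_le (hM ξ hξ)) hx hxC
  have hyC : MapsTo y (Icc 0 τ) C := fun t ht =>
    hC.isClosed.mem_of_tendsto (hlim t ht) (Eventually.of_forall fun k => hxC _ ht)
  have h0mem : (0 : ℝ) ∈ Icc 0 τ := left_mem_Icc.2 hτ.le
  have hle : v (y 0) ≤ v (y τ) := by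
    have hstart := (hv.continuous.tendsto _).comp (hlim 0 h0mem)
    have hend := ((hv.continuous.tendsto _).comp (hlim τ (right_mem_Icc.2 hτ.le))).add
      (tendsto_one_div_add_atTop_nhds_zero_nat.comp hφ.tendsto_atTop)
    rw [add_zero] at hend
    refine le_of_tendsto_of_tendsto' hstart hend fun k => ?_
    simpa [x, add_comm τ] using (hlt (φ k)).le
  exact h0 (hd.eq_zero_of_le hw hw0 hv hvw hy hτ hyC hle ▸ hyC h0mem)

end Arcs

section Trajectories

variable {n m : ℕ} {f : Fin m → EuclideanSpace ℝ (Fin n) → EuclideanSpace ℝ (Fin n)}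
  {χ : Fin m → Set (EuclideanSpace ℝ (Fin n))} {T' : Set (Trajectory f)}
  {V : EuclideanSpace ℝ (Fin n) → Fin m → ℝ} {W : Fin m → EuclideanSpace ℝ (Fin n) → ℝ}

theorem exists_pos_forall_isDwellInterval_add_le (hf : ∀ γ, Continuous (f γ))
    (hχ : ∀ γ, IsClosed (χ γ)) (hV : ∀ γ, Differentiable ℝ fun ξ => V ξ γ)
    (hWc : ∀ γ, Continuous (W γ)) (hW0 : ∀ γ, ∀ ξ ∈ χ γ, 0 ≤ W γ ξ)
    (hVW : ∀ γ, ∀ ξ ∈ χ γ, fderiv ℝ (fun η => V η γ) ξ (f γ ξ) ≤ -W γ ξ)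
    (hdist : ∀ γ, ZeroSmallTimeDistinguishable (f γ) (W γ)) {τ δ : ℝ} (hτ : 0 < τ) (hδ : 0 < δ)
    (R : ℝ) :
    ∃ c > 0, ∀ (p : Trajectory f) (b : ℝ), (∀ t ∈ p.dom, p.state t ∈ χ (p.signal t)) →
      IsDwellInterval p.signal b (b + τ) → b + τ ∈ p.dom →
      (∀ t ∈ Icc b (b + τ), δ ≤ ‖p.state t‖ ∧ ‖p.state t‖ ≤ R) →
      V (p.state (b + τ)) (p.signal b) + c ≤ V (p.state b) (p.signal b) := by
  let C : Fin m → Set (EuclideanSpace ℝ (Fin n)) := fun γ =>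
    χ γ ∩ (Metric.closedBall 0 R \ Metric.ball 0 δ)
  have hC : ∀ γ, IsCompact (C γ) := fun γ =>
    ((isCompact_closedBall 0 R).diff Metric.isOpen_ball).inter_left (hχ γ)
  choose c₀ hc₀ hdrop using fun γ => (hdist γ).exists_pos_forall_add_le (hf γ) (hWc γ)
    (fun ξ hξ => hW0 γ ξ hξ.1) (hV γ) (fun ξ hξ => hVW γ ξ hξ.1) (hC γ) (by simp [C, hδ]) hτ
  have hmin : ∀ᶠ c in 𝓝[>] (0 : ℝ), ∀ γ, c ≤ c₀ γ := eventually_all.2 fun γ =>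
    nhdsWithin_le_nhds (Iic_mem_nhds (hc₀ γ))
  obtain ⟨c, hc, hc0⟩ := (hmin.and self_mem_nhdsWithin).exists
  refine ⟨c, hc0, fun p b hp hdwell hdom hR => (add_le_add_right (hc (p.signal b)) _).trans ?_⟩
  refine hdrop _ _ b (p.isSolution.isSolutionArc p.isSwitchingSignal hdwell hdom) fun t ht => ?_
  exact ⟨Trajectory.mapsTo_of_isDwellInterval (hχ _) hp hdwell hdom rfl ht,
    mem_closedBall_zero_iff.2 (hR t ht).2, fun h => (mem_ball_zero_iff.1 h).not_ge (hR t ht).1⟩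

namespace IsWeakLyapunovLike

variable (hV : IsWeakLyapunovLike χ T' V) (hχ : ∀ γ, IsClosed (χ γ))
include hV hχ

theorem mul_card_le_of_forall_add_le {p : Trajectory f} (hpT : p ∈ T')
    (hp : ∀ t ∈ p.dom, p.state t ∈ χ (p.signal t)) {ι : Type*} [LinearOrder ι] {S : Finset ι}
    {b : ι → ℝ} {γ : Fin m} {τ c A : ℝ} (hτ : 0 ≤ τ) (hA : 0 ≤ A)
    (hdwell : ∀ i ∈ S, IsDwellInterval p.signal (b i) (b i + τ)) (hdom : ∀ i ∈ S, b i + τ ∈ p.dom)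
    (hlt : ∀ i ∈ S, ∀ j ∈ S, i < j → b i + τ ≤ b j) (hγ : ∀ i ∈ S, p.signal (b i) = γ)
    (hdrop : ∀ i ∈ S, V (p.state (b i + τ)) γ + c ≤ V (p.state (b i)) γ)
    (hVA : ∀ i ∈ S, V (p.state (b i)) γ ≤ A) : c * S.card ≤ A := by
  refine mul_card_le_of_forall_lt_add_le S hA (fun i hi => ?_) hVA fun i hi j hj hij => ?_
  · have hmem := Trajectory.mapsTo_of_isDwellInterval (hχ γ) hp (hdwell i hi) (hdom i hi) (hγ i hi)
      (right_mem_Icc.2 (le_add_of_nonneg_right hτ))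
    exact (le_add_of_nonneg_left (hV.nonneg hmem)).trans (hdrop i hi)
  · have hbj : b j ∈ p.dom := p.isSolution.interval.mem_of_le (hdom j hj) (hdwell j hj).nonneg
      (le_add_of_nonneg_right hτ)
    have hle := hV.le_of_signal_eq hχ hpT hp (le_add_of_nonneg_right hτ) (hlt i hi j hj hij) hbj
      (hdwell i hi) ((hγ i hi).trans (hγ j hj).symm)
    rw [hγ i hi, hγ j hj] at hle
    exact (add_le_add_left hle c).trans (hdrop i hi)

-- A trajectory that stays away from `0` has a dwell interval in each of `m k + 1` consecutive
-- windows. By the pigeonhole principle more than `k` of them belong to the same mode, whose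
-- function `V` drops by `c` on each of them and does not grow in between.
theorem exists_time_norm_lt (hf : ∀ γ, Continuous (f γ)) (hT : T' ⊆ coveringTrajectories f χ)
    (hWc : ∀ γ, Continuous (W γ)) (hW0 : ∀ γ, ∀ ξ ∈ χ γ, 0 ≤ W γ ξ)
    (hVW : ∀ γ, ∀ ξ ∈ χ γ, fderiv ℝ (fun η => V η γ) ξ (f γ ξ) ≤ -W γ ξ)
    (hdist : ∀ γ, ZeroSmallTimeDistinguishable (f γ) (W γ)) {τ L : ℝ} (hτ : 0 < τ)
    (hdwell : ∀ p ∈ T', HasPersistentDwellTime τ L p.signal) {δ : ℝ} (hδ : 0 < δ) (R : ℝ) :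
    ∃ T : ℝ, ∀ p ∈ T', p.dom = Ici 0 → ∀ t₀, 0 ≤ t₀ → (∀ t, t₀ ≤ t → ‖p.state t‖ ≤ R) →
      ∃ t, t₀ ≤ t ∧ t ≤ t₀ + T ∧ ‖p.state t‖ < δ := by
  obtain ⟨α₁, α₂, -, hα₂, hbd⟩ := hV.bounds
  obtain ⟨c, hc, hdrop⟩ := exists_pos_forall_isDwellInterval_add_le hf hχ
    (fun γ => (hV.contDiff γ).differentiable one_ne_zero) hWc hW0 hVW hdist hτ hδ R
  obtain ⟨k, hk⟩ := exists_nat_gt (α₂ R.toNNReal / c : ℝ)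
  refine ⟨(m * k + 1 : ℕ) * L, fun p hp hdom t₀ ht₀ hR => ?_⟩
  by_contra! haway
  have hmem : ∀ t, t₀ ≤ t → t ∈ p.dom := fun t ht => hdom ▸ ht₀.trans ht
  obtain ⟨b, htb, hb, hlt, hend⟩ := (hdwell p hp).exists_seq hτ.le ht₀
  have hbτ : ∀ i, b i + τ ∈ p.dom := fun i => hmem _ ((htb i).trans (le_add_of_nonneg_right hτ.le))
  obtain ⟨γ, -, hγ⟩ := Finset.exists_lt_card_fiber_of_mul_lt_card_of_maps_to
    (s := Finset.range (m * k + 1)) (t := Finset.univ) (n := k) (f := fun i => p.signal (b i))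
    (fun _ _ => Finset.mem_univ _) (by simp)
  have hcard : c * ((Finset.range (m * k + 1)).filter fun i => p.signal (b i) = γ).card ≤
      α₂ R.toNNReal := by
    refine hV.mul_card_le_of_forall_add_le hχ hp (hT hp).2 hτ.le NNReal.zero_le_coe
      (fun i _ => hb i) (fun i _ => hbτ i) (fun i _ j _ hij => hlt i j hij)
      (fun i hi => (Finset.mem_filter.1 hi).2) (fun i hi => ?_) fun i hi => ?_ <;>
      obtain ⟨hiN, rfl⟩ := Finset.mem_filter.1 hi
    · refine hdrop p (b i) (hT hp).2 (hb i) (hbτ i) fun t ht => ?_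
      have ht₀t := (htb i).trans ht.1
      exact ⟨haway t ht₀t (ht.2.trans (hend i _ (Finset.mem_range.1 hiN))), hR t ht₀t⟩
    · refine (hbd _ _ ((hT hp).2 _ (hmem _ (htb i)))).2.trans (NNReal.coe_le_coe.2 ?_)
      exact hα₂.strictMono.monotone (NNReal.le_toNNReal_of_coe_le (hR _ (htb i)))
  rw [div_lt_iff₀' hc] at hk
  refine (hk.trans_le ?_).not_ge hcard
  gcongr

end IsWeakLyapunovLike

end Trajectories

end Dissipation

section Majorant

/-- The average of `h` over `[r, 2 r]`, the device that makes a monotone function continuous at the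
cost of a factor `2` in its argument. The substitution `v = r u` gives it a meaning at `r = 0`. -/
noncomputable def forwardAverage (h : ℝ → ℝ) (r : ℝ) : ℝ :=
  ∫ u in (1 : ℝ)..2, h (r * u)

section ForwardAverage

variable {h : ℝ → ℝ} {r : ℝ}

theorem intervalIntegrable_comp_mul_left (hh : Monotone h) (hr : 0 ≤ r) :
    IntervalIntegrable (fun u => h (r * u)) MeasureTheory.volume 1 2 :=
  (hh.comp (monotone_mul_left_of_nonneg hr)).intervalIntegrable

theorem le_forwardAverage (hh : Monotone h) (hr : 0 ≤ r) : h r ≤ forwardAverage h r := by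
  have hle := intervalIntegral.integral_mono_on one_le_two (intervalIntegrable_const (c := h r))
    (intervalIntegrable_comp_mul_left hh hr) fun u hu => hh (le_mul_of_one_le_right hr hu.1)
  rwa [intervalIntegral.integral_const, show (2 : ℝ) - 1 = 1 by norm_num, one_smul] at hle

theorem forwardAverage_le (hh : Monotone h) (hr : 0 ≤ r) : forwardAverage h r ≤ h (r * 2) := by
  have hle := intervalIntegral.integral_mono_on one_le_two
    (intervalIntegrable_comp_mul_left hh hr) (intervalIntegrable_const (c := h (r * 2)))
    fun u hu => hh (mul_le_mul_of_nonneg_left hu.2 hr)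
  rwa [intervalIntegral.integral_const, show (2 : ℝ) - 1 = 1 by norm_num, one_smul] at hle

theorem forwardAverage_mono {k : ℝ → ℝ} (hh : Monotone h) (hk : Monotone k) (hhk : h ≤ k)
    (hr : 0 ≤ r) : forwardAverage h r ≤ forwardAverage k r :=
  intervalIntegral.integral_mono_on one_le_two (intervalIntegrable_comp_mul_left hh hr)
    (intervalIntegrable_comp_mul_left hk hr) fun u _ => hhk (r * u)

theorem monotoneOn_forwardAverage (hh : Monotone h) : MonotoneOn (forwardAverage h) (Ici 0) :=
  fun _ hr _ hs hrs => intervalIntegral.integral_mono_on one_le_two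
    (intervalIntegrable_comp_mul_left hh hr) (intervalIntegrable_comp_mul_left hh hs) fun _ hu =>
      hh (mul_le_mul_of_nonneg_right hrs (zero_le_one.trans hu.1))

theorem continuousAt_forwardAverage (hh : Monotone h) (hr : 0 < r) :
    ContinuousAt (forwardAverage h) r := by
  have hint : ∀ a b, IntervalIntegrable h MeasureTheory.volume a b := fun a b =>
    hh.intervalIntegrable
  have hprim := intervalIntegral.continuous_primitive hint 0
  have hcont : ContinuousAt (fun r : ℝ =>
      r⁻¹ * ((∫ v in (0 : ℝ)..(r * 2), h v) - ∫ v in (0 : ℝ)..(r * 1), h v)) r := by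
    refine (continuousAt_inv₀ hr.ne').mul (Continuous.continuousAt ?_)
    exact (hprim.comp (continuous_mul_const 2)).sub (hprim.comp (continuous_mul_const 1))
  refine hcont.congr ?_
  filter_upwards [Ioi_mem_nhds hr] with s hs
  rw [forwardAverage, intervalIntegral.integral_comp_mul_left _ (ne_of_gt hs), smul_eq_mul,
    intervalIntegral.integral_interval_sub_left (hint _ _) (hint _ _)]

theorem continuousOn_forwardAverage (hh : Monotone h) (h0 : ContinuousWithinAt h (Ici 0) 0) :
    ContinuousOn (forwardAverage h) (Ici 0) := by
  intro r hr
  rcases (mem_Ici.1 hr).eq_or_lt with rfl | hr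
  · have hzero : forwardAverage h 0 = h 0 :=
      le_antisymm ((forwardAverage_le hh le_rfl).trans_eq (by rw [zero_mul]))
        (le_forwardAverage hh le_rfl)
    have hdouble : Tendsto (fun r => h (r * 2)) (𝓝[≥] 0) (𝓝 (h 0)) := by
      refine h0.tendsto.comp (tendsto_nhdsWithin_iff.2 ⟨?_, ?_⟩)
      · exact ((continuous_mul_const (2 : ℝ)).tendsto' 0 0 (zero_mul 2)).mono_left
          nhdsWithin_le_nhds
      · filter_upwards [self_mem_nhdsWithin] with r hr using mul_nonneg (mem_Ici.1 hr) zero_le_two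
    rw [ContinuousWithinAt, hzero]
    refine tendsto_of_tendsto_of_tendsto_of_le_of_le' h0 hdouble ?_ ?_ <;>
      filter_upwards [self_mem_nhdsWithin] with r hr
    exacts [le_forwardAverage hh hr, forwardAverage_le hh hr]
  · exact (continuousAt_forwardAverage hh hr).continuousWithinAt

end ForwardAverage

-- The summand `r / (1 + t)` makes the merely monotone `F` strictly increasing and unbounded in `r`.
theorem isClassKL_div_add {F : ℝ≥0 → ℝ≥0 → ℝ≥0} (hF0 : ∀ t, F 0 t = 0)
    (hFc : ∀ t, Continuous fun r => F r t) (hFm : ∀ t, Monotone fun r => F r t)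
    (hFa : ∀ r, Antitone (F r)) (hFlim : ∀ r, Tendsto (F r) atTop (𝓝 0)) :
    IsClassKL fun r t => r / (1 + t) + F r t where
  left t := by
    have ht : 0 < 1 + t := by positivity
    refine IsClassKInfty.add_monotone (α := fun r => r / (1 + t)) ⟨fun r s hrs => ?_, by fun_prop,
      zero_div _, fun M => ⟨(M + 1) * (1 + t), ?_⟩⟩ (hFm t) (hFc t) (hF0 t)
    · exact div_lt_div_of_pos_right hrs ht
    · rw [mul_div_cancel_right₀ _ ht.ne']
      exact lt_add_one M
  right_antitone r s t hst := add_le_add (by gcongr) (hFa r hst)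
  right_tendsto r := by
    have hdiv : Tendsto (fun t : ℝ≥0 => r / (1 + t)) atTop (𝓝 0) := by
      rw [← NNReal.tendsto_coe]
      push_cast
      exact Tendsto.const_div_atTop (tendsto_atTop_add_const_left _ _
        (NNReal.tendsto_coe_atTop.2 tendsto_id)) (r : ℝ)
    simpa using hdiv.add (hFlim r)

theorem exists_isClassKL_of_monotone {ψ : ℝ → ℝ≥0 → ℝ} (h0 : ∀ t, ψ 0 t = 0)
    (hcont : ∀ t, ContinuousWithinAt (fun r => ψ r t) (Ici 0) 0)
    (hmono : ∀ t, Monotone fun r => ψ r t) (hanti : ∀ r, Antitone (ψ r))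
    (hlim : ∀ r, Tendsto (ψ r) atTop (𝓝 0)) :
    ∃ β, IsClassKL β ∧ ∀ r t : ℝ≥0, ψ r t ≤ β r t := by
  let F : ℝ≥0 → ℝ≥0 → ℝ := fun r t => forwardAverage (fun r => ψ r t) r
  have hle : ∀ (r : ℝ≥0) t, F r t ≤ ψ (r * 2) t := fun r t =>
    forwardAverage_le (hmono t) r.coe_nonneg
  have hge : ∀ (r : ℝ≥0) t, ψ r t ≤ F r t := fun r t => le_forwardAverage (hmono t) r.coe_nonneg
  have hψ0 : ∀ (r : ℝ≥0) t, 0 ≤ ψ r t := fun r t => (h0 t).ge.trans (hmono t r.coe_nonneg)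
  refine ⟨_, isClassKL_div_add (F := fun r t => (F r t).toNNReal) (fun t => ?_) (fun t => ?_)
    (fun t r s hrs => ?_) (fun r s t hst => ?_) (fun r => ?_), fun r t => ?_⟩
  · have hF0 := hle 0 t
    rw [NNReal.coe_zero, zero_mul, h0] at hF0
    exact Real.toNNReal_of_nonpos hF0
  · exact continuous_real_toNNReal.comp <|
      (continuousOn_forwardAverage (hmono t) (hcont t)).comp_continuous NNReal.continuous_coe
        fun r => r.coe_nonneg
  · exact Real.toNNReal_le_toNNReal
      (monotoneOn_forwardAverage (hmono t) r.coe_nonneg s.coe_nonneg hrs)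
  · exact Real.toNNReal_le_toNNReal
      (forwardAverage_mono (hmono t) (hmono s) (fun u => hanti u hst) r.coe_nonneg)
  · have hFlim : Tendsto (F r) atTop (𝓝 0) :=
      squeeze_zero (fun t => (hψ0 r t).trans (hge r t)) (hle r) (hlim _)
    exact (continuous_real_toNNReal.tendsto' 0 0 Real.toNNReal_zero).comp hFlim
  · exact (hge r t).trans ((Real.le_coe_toNNReal _).trans (NNReal.coe_le_coe.2 le_add_self))

end Majorant

section Stability

variable {n m : ℕ} {f : Fin m → EuclideanSpace ℝ (Fin n) → EuclideanSpace ℝ (Fin n)}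
  {T' : Set (Trajectory f)} {t t' : ℝ≥0} {r r' ε : ℝ} {p : Trajectory f}

/-- Uniform attractivity: the time that the trajectories starting in a given ball need to enter a
given smaller ball for good depends neither on the trajectory nor on the initial time. -/
def UniformlyAttractive (T' : Set (Trajectory f)) : Prop :=
  ∀ r ε : ℝ, 0 < ε → ∃ T : ℝ, ∀ p ∈ T', ∀ t₀ t : ℝ, 0 ≤ t₀ → t₀ ≤ t → t₀ + T ≤ t →
    ‖p.state t₀‖ ≤ r → ‖p.state t‖ ≤ ε

/-- The norms that the trajectories of `T'` can attain at time `t` or later after being in the ball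
of radius `r`. The value `0` is always included, so that the supremum of this set is meaningful
for all `T'` and `r`. -/
def attainableNorms (T' : Set (Trajectory f)) (r : ℝ) (t : ℝ≥0) : Set ℝ :=
  insert 0 {y | ∃ p ∈ T', ∃ t₀ s : ℝ, 0 ≤ t₀ ∧ (t : ℝ) ≤ s ∧ ‖p.state t₀‖ ≤ r ∧
    ‖p.state (t₀ + s)‖ = y}

/-- The largest norm in `attainableNorms T' r t`: the smallest possible `𝒦ℒ`-type bound for `T'`,
which in general is neither continuous nor strictly increasing in `r`. -/
noncomputable def worstNorm (T' : Set (Trajectory f)) (r : ℝ) (t : ℝ≥0) : ℝ :=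
  sSup (attainableNorms T' r t)

theorem attainableNorms_subset (hr : r ≤ r') (ht : t' ≤ t) :
    attainableNorms T' r t ⊆ attainableNorms T' r' t' := by
  refine insert_subset_insert ?_
  rintro y ⟨p, hp, t₀, s, ht₀, hts, hpr, hy⟩
  exact ⟨p, hp, t₀, s, ht₀, (NNReal.coe_le_coe.2 ht).trans hts, hpr.trans hr, hy⟩

theorem worstNorm_le (hε : 0 ≤ ε)
    (h : ∀ p ∈ T', ∀ t₀ s : ℝ, 0 ≤ t₀ → t ≤ s → ‖p.state t₀‖ ≤ r → ‖p.state (t₀ + s)‖ ≤ ε) :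
    worstNorm T' r t ≤ ε := by
  refine csSup_le ⟨0, mem_insert _ _⟩ ?_
  rintro y (rfl | ⟨p, hp, t₀, s, ht₀, hts, hr, rfl⟩)
  exacts [hε, h p hp t₀ s ht₀ hts hr]

section Bounded

variable {α : ℝ≥0 → ℝ≥0} (hα : Monotone α)
  (hT : ∀ p ∈ T', ∀ t₀ t : ℝ, 0 ≤ t₀ → t₀ ≤ t → ‖p.state t‖₊ ≤ α ‖p.state t₀‖₊)
include hα hT

theorem norm_add_le_of_nnnorm_le {t₀ s : ℝ} (hp : p ∈ T') (ht₀ : 0 ≤ t₀) (hs : 0 ≤ s)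
    (hr : ‖p.state t₀‖ ≤ r) : ‖p.state (t₀ + s)‖ ≤ α r.toNNReal :=
  NNReal.coe_le_coe.2 ((hT p hp t₀ (t₀ + s) ht₀ (le_add_of_nonneg_right hs)).trans
    (hα (NNReal.le_toNNReal_of_coe_le hr)))

theorem bddAbove_attainableNorms : BddAbove (attainableNorms T' r t) := by
  refine ⟨α r.toNNReal, ?_⟩
  rintro y (rfl | ⟨p, hp, t₀, s, ht₀, hts, hr, rfl⟩)
  exacts [NNReal.coe_nonneg _,
    norm_add_le_of_nnnorm_le hα hT hp ht₀ (t.coe_nonneg.trans hts) hr]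

theorem worstNorm_nonneg : 0 ≤ worstNorm T' r t :=
  le_csSup (bddAbove_attainableNorms hα hT) (mem_insert _ _)

theorem worstNorm_mono (hr : r ≤ r') (ht : t' ≤ t) : worstNorm T' r t ≤ worstNorm T' r' t' :=
  csSup_le_csSup (bddAbove_attainableNorms hα hT) ⟨0, mem_insert _ _⟩ (attainableNorms_subset hr ht)

theorem norm_le_worstNorm {t₀ t : ℝ} (hp : p ∈ T') (ht₀ : 0 ≤ t₀) (htt : t₀ ≤ t) :
    ‖p.state t‖ ≤ worstNorm T' ‖p.state t₀‖ (t - t₀).toNNReal :=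
  le_csSup (bddAbove_attainableNorms hα hT) (mem_insert_of_mem _ ⟨p, hp, t₀, t - t₀, ht₀,
    (Real.coe_toNNReal _ (sub_nonneg.2 htt)).le, le_rfl, by rw [add_sub_cancel]⟩)

theorem worstNorm_le_of_nnnorm_le : worstNorm T' r t ≤ α r.toNNReal :=
  worstNorm_le NNReal.zero_le_coe fun _ hp _ _ ht₀ hts hr =>
    norm_add_le_of_nnnorm_le hα hT hp ht₀ (t.coe_nonneg.trans hts) hr

theorem UniformlyAttractive.tendsto_worstNorm (hatt : UniformlyAttractive T') :
    Tendsto (worstNorm T' r) atTop (𝓝 0) := by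
  refine tendsto_order.2 ⟨fun a ha => Eventually.of_forall fun t =>
    ha.trans_le (worstNorm_nonneg hα hT), fun ε hε => ?_⟩
  obtain ⟨T, hT'⟩ := hatt r (ε / 2) (half_pos hε)
  filter_upwards [eventually_ge_atTop T.toNNReal] with t ht
  refine (worstNorm_le (half_pos hε).le fun p hp t₀ s ht₀ hts hr => ?_).trans_lt (half_lt_self hε)
  exact hT' p hp t₀ (t₀ + s) ht₀ (le_add_of_nonneg_right (t.coe_nonneg.trans hts))
    (add_le_add_right ((Real.toNNReal_le_iff_le_coe.1 ht).trans hts) t₀) hr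

end Bounded

theorem UniformlyStable.globallyUniformlyAsymptoticallyStable (hT : UniformlyStable T')
    (hatt : UniformlyAttractive T') : GloballyUniformlyAsymptoticallyStable T' := by
  obtain ⟨α, hα, hαT⟩ := hT
  have hmono := hα.strictMono.monotone
  have hle : ∀ p ∈ T', ∀ t₀ t : ℝ, 0 ≤ t₀ → t₀ ≤ t → ‖p.state t‖₊ ≤ α ‖p.state t₀‖₊ :=
    fun p hp => (hαT p hp).2
  have hα0 : Tendsto (fun r : ℝ => (α r.toNNReal : ℝ)) (𝓝 0) (𝓝 0) :=
    (NNReal.continuous_coe.comp (hα.continuous.comp continuous_real_toNNReal)).tendsto' _ _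
      (by simp [hα.map_zero])
  have hzero : ∀ t, worstNorm T' 0 t = 0 := fun t =>
    ((worstNorm_le_of_nnnorm_le hmono hle).trans_eq (by simp [hα.map_zero])).antisymm
      (worstNorm_nonneg hmono hle)
  have hcont : ∀ t, ContinuousWithinAt (fun r => worstNorm T' r t) (Ici 0) 0 := fun t => by
    rw [ContinuousWithinAt, hzero]
    exact (squeeze_zero (fun _ => worstNorm_nonneg hmono hle)
      (fun _ => worstNorm_le_of_nnnorm_le hmono hle) hα0).mono_left nhdsWithin_le_nhds
  obtain ⟨β, hβ, hβle⟩ := exists_isClassKL_of_monotone hzero hcont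
    (fun t r r' hr => worstNorm_mono hmono hle hr le_rfl)
    (fun r t t' ht => worstNorm_mono hmono hle le_rfl ht)
    (fun r => hatt.tendsto_worstNorm hmono hle)
  exact ⟨β, hβ, fun p hp => ⟨(hαT p hp).1, fun t₀ t ht₀ htt => NNReal.coe_le_coe.1 <|
    (norm_le_worstNorm hmono hle hp ht₀ htt).trans (hβle ‖p.state t₀‖₊ _)⟩⟩

theorem GloballyUniformlyAsymptoticallyStable.tendsto_zero
    (h : GloballyUniformlyAsymptoticallyStable T') (hp : p ∈ T') :
    Tendsto p.state atTop (𝓝 0) := by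
  obtain ⟨β, hβ, hβT⟩ := h
  refine squeeze_zero_norm' (a := fun t : ℝ => (β ‖p.state 0‖₊ t.toNNReal : ℝ)) ?_
    ((NNReal.tendsto_coe.2 (hβ.right_tendsto _)).comp tendsto_real_toNNReal_atTop)
  filter_upwards [eventually_ge_atTop 0] with t ht
  have hle := (hβT p hp).2 0 t le_rfl ht
  rw [sub_zero] at hle
  exact NNReal.coe_le_coe.2 hle

theorem UniformlyStable.uniformlyAttractive (hT : UniformlyStable T')
    (hreach : ∀ δ R : ℝ, 0 < δ → ∃ T : ℝ, ∀ p ∈ T', ∀ t₀, 0 ≤ t₀ →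
      (∀ t, t₀ ≤ t → ‖p.state t‖ ≤ R) → ∃ t, t₀ ≤ t ∧ t ≤ t₀ + T ∧ ‖p.state t‖ < δ) :
    UniformlyAttractive T' := by
  intro r ε hε
  obtain ⟨α, hα, hαT⟩ := hT
  obtain ⟨β, hβ, hαβ⟩ := hα.exists_rightInverse
  have hβε : 0 < β ε.toNNReal :=
    hβ.map_zero.ge.trans_lt (hβ.strictMono (Real.toNNReal_pos.2 hε))
  obtain ⟨T, hreachT⟩ := hreach (β ε.toNNReal) (α r.toNNReal) (NNReal.coe_pos.2 hβε)
  refine ⟨T, fun p hp t₀ t ht₀ _ hTt hr => ?_⟩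
  obtain ⟨s, hs, hsT, hsβ⟩ := hreachT p hp t₀ ht₀ fun u hu =>
    NNReal.coe_le_coe.2 (((hαT p hp).2 t₀ u ht₀ hu).trans
      (hα.strictMono.monotone (NNReal.le_toNNReal_of_coe_le hr)))
  have hε' : ‖p.state t‖₊ ≤ ε.toNNReal :=
    calc ‖p.state t‖₊ ≤ α ‖p.state s‖₊ := (hαT p hp).2 s t (ht₀.trans hs) (hsT.trans hTt)
      _ ≤ α (β ε.toNNReal) := hα.strictMono.monotone (NNReal.coe_le_coe.1 hsβ.le)
      _ = ε.toNNReal := hαβ _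
  exact (Real.le_toNNReal_iff_coe_le hε.le).1 hε'

end Stability

theorem IsWeakLyapunovLike.globallyUniformlyAsymptoticallyStable {n m : ℕ}
    {f : Fin m → EuclideanSpace ℝ (Fin n) → EuclideanSpace ℝ (Fin n)}
    {χ : Fin m → Set (EuclideanSpace ℝ (Fin n))} {T' : Set (Trajectory f)}
    {V : EuclideanSpace ℝ (Fin n) → Fin m → ℝ} {W : Fin m → EuclideanSpace ℝ (Fin n) → ℝ}
    (hV : IsWeakLyapunovLike χ T' V) (hχ : ∀ γ, IsClosed (χ γ)) (hf : ∀ γ, Continuous (f γ))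
    (hT : T' ⊆ coveringTrajectories f χ) (hWc : ∀ γ, Continuous (W γ))
    (hW0 : ∀ γ, ∀ ξ ∈ χ γ, 0 ≤ W γ ξ)
    (hVW : ∀ γ, ∀ ξ ∈ χ γ, fderiv ℝ (fun η => V η γ) ξ (f γ ξ) ≤ -W γ ξ)
    (hdist : ∀ γ, ZeroSmallTimeDistinguishable (f γ) (W γ)) {τ L : ℝ} (hτ : 0 < τ)
    (hdwell : ∀ p ∈ T', HasPersistentDwellTime τ L p.signal) :
    GloballyUniformlyAsymptoticallyStable T' := by
  have hstable := hV.uniformlyStable hχ hf hT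
  refine hstable.globallyUniformlyAsymptoticallyStable
    (hstable.uniformlyAttractive fun δ R hδ => ?_)
  obtain ⟨T, hreach⟩ := hV.exists_time_norm_lt hχ hf hT hWc hW0 hVW hdist hτ hdwell hδ R
  obtain ⟨α, -, hdom⟩ := hstable
  exact ⟨T, fun p hp => hreach p hp (hdom p hp).1⟩

end SwitchedSystem

open SwitchedSystem in
theorem theorem3_general {n m : ℕ}
    {f : Fin m → EuclideanSpace ℝ (Fin n) → EuclideanSpace ℝ (Fin n)}
    (hf : ∀ γ, Continuous (f γ))
    {χ : Fin m → Set (EuclideanSpace ℝ (Fin n))} (hχ : ∀ γ, IsClosed (χ γ))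
    {T' : Set (Trajectory f)} (hTχ : T' ⊆ coveringTrajectories f χ)
    (hTd : ∀ p ∈ T', ∃ τ L, 0 < τ ∧ HasPersistentDwellTime τ L p.signal)
    {V : EuclideanSpace ℝ (Fin n) → Fin m → ℝ} (hV : IsWeakLyapunovLike χ T' V)
    {W : Fin m → EuclideanSpace ℝ (Fin n) → ℝ} (hWc : ∀ γ, Continuous (W γ))
    (hW0 : ∀ γ, ∀ ξ ∈ χ γ, 0 ≤ W γ ξ)
    (hVW : ∀ γ, ∀ ξ ∈ χ γ, fderiv ℝ (fun η => V η γ) ξ (f γ ξ) ≤ -W γ ξ)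
    (hdist : ∀ γ, ZeroSmallTimeDistinguishable (f γ) (W γ)) :
    GloballyAsymptoticallyStable T' ∧
      ((∃ τ L, 0 < τ ∧ ∀ p ∈ T', HasPersistentDwellTime τ L p.signal) →
        GloballyUniformlyAsymptoticallyStable T') := by
  refine ⟨⟨hV.uniformlyStable hχ hf hTχ, fun p hp => ?_⟩, ?_⟩
  · obtain ⟨τ, L, hτ, hdwell⟩ := hTd p hp
    have hsub : {p} ⊆ T' := singleton_subset_iff.2 hp
    exact ((hV.mono hsub).globallyUniformlyAsymptoticallyStable hχ hf (hsub.trans hTχ) hWc hW0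
      hVW hdist hτ fun _ hq => hq ▸ hdwell).tendsto_zero (mem_singleton p)
  · rintro ⟨τ, L, hτ, hdwell⟩
    exact hV.globallyUniformlyAsymptoticallyStable hχ hf hTχ hWc hW0 hVW hdist hτ hdwell

theorem theorem3 {n m : ℕ}
    (f : Fin m → EuclideanSpace ℝ (Fin n) → EuclideanSpace ℝ (Fin n))
    (hf : ∀ γ, Continuous (f γ))
    (χ : Fin m → Set (EuclideanSpace ℝ (Fin n)))
    (hχ : SwitchedSystem.IsClosedCovering χ)
    (hf0 : ∀ γ, (0 : EuclideanSpace ℝ (Fin n)) ∈ χ γ → f γ 0 = 0)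
    (T' : Set (SwitchedSystem.Trajectory f))
    (hTχ : T' ⊆ SwitchedSystem.coveringTrajectories f χ)
    (hTa : T' ⊆ SwitchedSystem.averageDwellTrajectories f)
    (V : EuclideanSpace ℝ (Fin n) → Fin m → ℝ)
    (hV : SwitchedSystem.IsWeakLyapunovLike χ T' V)
    (W : Fin m → EuclideanSpace ℝ (Fin n) → ℝ)
    (hWcont : ∀ γ, Continuous (W γ))
    (hWnonneg : ∀ γ ξ, 0 ≤ W γ ξ)
    (hVW : ∀ γ, ∀ ξ ∈ χ γ, fderiv ℝ (fun η => V η γ) ξ (f γ ξ) ≤ -W γ ξ)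
    (hdist : ∀ γ, SwitchedSystem.ZeroSmallTimeDistinguishable (f γ) (W γ)) :
    SwitchedSystem.GloballyAsymptoticallyStable T' ∧
      ((∃ (τD : ℝ) (N0 : ℕ), 0 < τD ∧ T' ⊆ SwitchedSystem.dwellTrajectories f τD N0) →
        SwitchedSystem.GloballyUniformlyAsymptoticallyStable T') := by
  refine (theorem3_general hf hχ.closed hTχ (fun p hp => ?_) hV hWcont (fun γ ξ _ => hWnonneg γ ξ)
    hVW hdist).imp_right fun h ⟨_, _, hτD, hTd⟩ => h ⟨_, _, by positivity, fun p hp =>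
      (hTd hp).2.hasPersistentDwellTime p.isSwitchingSignal hτD⟩
  obtain ⟨_, _, hτD, -, hpd⟩ := hTa hp
  exact ⟨_, _, by positivity, hpd.2.hasPersistentDwellTime p.isSwitchingSignal hτD⟩
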